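/- Let $(R,\mathfrak m)$ be a $3$-dimensional (Noetherian) Cohen–Macaulay local ring of characteristic $2$, and let $x,y,z$ be a system of parameters for $R$. Let $\alpha,\beta,\gamma,\alpha',\beta',\gamma'$ be positive integers with $$\alpha=1,\quad \alpha'=2,\quad 2\beta\le\beta',\quad 2\gamma\le\gamma',$$ and let $I$ be the ideal of $R$ generated by the maximal minors of the matrix $$\begin{pmatrix} x^{\alpha} & y^{\beta} & z^{\gamma}\\ y^{\beta'} & z^{\gamma'} & x^{\alpha'}\end{pmatrix}.$$ Put $Q=(x^{\min\{\alpha,\alpha'\}},\,y^{\min\{\beta,\beta'\}},\,z^{\min\{\gamma,\gamma'\}})R$ (so $Q=(x,y^{\beta},z^{\gamma})R$), and let $$I^{(3)}=\bigcap_{\mathfrak p\in\operatorname{Min}_R(R/I)}\bigl(I^3R_{\mathfrak p}\cap R\bigr)$$ be the third symbolic power of $I$. Then $$\operatorname{depth} R/(I^3:_R Q^3)>0\qquad\text{and}\qquad I^{(3)}=I^3:_R Q^3 .$$ Moreover, writing $\ell_R$ for length of $R$-modules, $$\ell_R\bigl(I^{(3)}/I^3\bigr)=7\cdot\ell_R(R/Q)=7\beta\gamma\cdot\ell_R\bigl(R/(x,y,z)R\bigr).$$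 -/

import Mathlib

/-- The depth of a module `M` over a local ring `R`: the supremum of the lengths of the
`M`-regular sequences contained in the maximal ideal. -/
noncomputable def moduleDepth (R : Type*) [CommRing R] [IsLocalRing R]
    (M : Type*) [AddCommGroup M] [Module R M] : ℕ∞ :=
  ⨆ (rs : List R) (_ : (∀ r ∈ rs, r ∈ IsLocalRing.maximalIdeal R) ∧
    RingTheory.Sequence.IsRegular M rs), (rs.length : ℕ∞)

/-- A Cohen-Macaulay local ring: a Noetherian local ring whose depth equals its Krull dimension. -/
class IsCohenMacaulayLocalRing (R : Type*) [CommRing R] : Prop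
    extends IsLocalRing R, IsNoetherianRing R where
  depth_eq_dim : (moduleDepth R R : WithBot ℕ∞) = ringKrullDim R

/-- `d` elements of a local ring of Krull dimension `d` that generate an ideal which is primary
to the maximal ideal. -/
def IsSystemOfParameters {R : Type*} [CommRing R] [IsLocalRing R] {d : ℕ} (s : Fin d → R) : Prop :=
  ringKrullDim R = d ∧ (Ideal.span (Set.range s)).radical = IsLocalRing.maximalIdeal R

/-- The ideal generated by the maximal minors of an `m × n` matrix, where `m ≤ n`. -/
def maximalMinorsIdeal {R : Type*} [CommRing R] {m n : ℕ} (A : Matrix (Fin m) (Fin n) R) :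
    Ideal R :=
  Ideal.span (Set.range fun f : Fin m ↪o Fin n => (A.submatrix id f).det)

/-- The `n`-th symbolic power of `I`: the intersection, over the minimal primes `p` of `I`,
of the preimages in `R` of the ideals `I ^ n R_p`. -/
def symbolicPower {R : Type*} [CommRing R] (I : Ideal R) (n : ℕ) : Ideal R :=
  ⨅ (p : PrimeSpectrum R) (_ : p.asIdeal ∈ I.minimalPrimes),
    ((I ^ n).map (algebraMap R (Localization.AtPrime p.asIdeal))).comap
      (algebraMap R (Localization.AtPrime p.asIdeal))

/-- The length of the `R`-module `J / K`, for ideals `K ⊆ J`. -/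
noncomputable def quotientLength {R : Type*} [CommRing R] (J K : Ideal R) : ℕ∞ :=
  Module.length R (J ⧸ Submodule.submoduleOf K J)

theorem pow_le_symbolicPower {R : Type*} [CommRing R] (I : Ideal R) (n : ℕ) :
    I ^ n ≤ symbolicPower I n :=
  le_iInf fun _ => le_iInf fun _ => Ideal.le_comap_map

/-! Put a = x, b = y^β, c = z^γ, u = y^(β'-2β), v = z^(γ'-2γ). The rows are then (a, b, c) and (u
b², v c², a²), with minors f, g, h. In characteristic 2 the element u f h² + v g³ is divisible by
a²; let d be the quotient and J = I³ + (d). The claim is that J is both the symbolic cube and the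
colon ideal.

The core is that a is a nonzerodivisor on R/I and on R/J. Modulo a the generators of J become v³c⁹,
u v³c⁷ + u³b⁷, u v²b²c⁷, ..., u³b⁹, and their syzygies are computed by eliminating one coefficient
at a time (`syzygies_of_cubic_monomials`). Each syzygy lifts to a relation over R (`rel_top_row`,
`rel_c_sq`, `rel_b_sq`, `rel_abc`, `rel_a_sq`), which makes a regular on R/J (`exists_division`).
The coefficients of d in the lifts also give (I³ : d) = C := (a², b², c², abc)
(`mul_d_mem_cube_iff`).

The rest is formal. Since a²J ⊆ I³ and a is a parameter modulo I, J is the symbolic cube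
(`symbolicPower_eq_of_isRegularMod`). Since Q³ ⊆ C, Q³J ⊆ I³, while a³t ∈ I³ forces t ∈ J; so J = I³
: Q³. Finally J/I³ ≅ R/C, and (a², b², c²) : abc = Q gives length (8 - 1)·ℓ(R/Q). The Cohen–Macaulay
property enters through the fact that systems of parameters are regular sequences
(`isRegularMod_of_radical_span_eq`). -/

open IsLocalRing

/-- `r` is a nonzerodivisor on `R ⧸ A`. -/
def IsRegularMod {R : Type*} [CommRing R] (A : Ideal R) (r : R) : Prop :=
  ∀ t, r * t ∈ A → t ∈ A

/-- `R ⧸ A` admits a weakly regular sequence of length `n` in the maximal ideal. -/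
def HasRegularSeqMod {R : Type*} [CommRing R] [IsLocalRing R] : ℕ → Ideal R → Prop
  | 0, _ => True
  | n + 1, A => ∃ r ∈ maximalIdeal R, IsRegularMod A r ∧ HasRegularSeqMod n (A ⊔ Ideal.span {r})

/-! ### Nonzerodivisors modulo an ideal. -/

section CommRing

variable {R : Type*} [CommRing R] {A : Ideal R} {r s : R}

theorem isRegularMod_iff_isSMulRegular : IsRegularMod A r ↔ IsSMulRegular (R ⧸ A) r :=
  (isSMulRegular_quotient_iff_mem_of_smul_mem A r).symm

theorem mem_sup_span_singleton' {t : R} :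
    t ∈ A ⊔ Ideal.span {r} ↔ ∃ w, t - r * w ∈ A := by
  rw [Submodule.mem_sup]
  constructor
  · rintro ⟨y, hy, z, hz, rfl⟩
    obtain ⟨w, rfl⟩ := Ideal.mem_span_singleton'.1 hz
    exact ⟨w, by convert! hy using 1; ring⟩
  · rintro ⟨w, hw⟩
    exact ⟨_, hw, r * w, Ideal.mul_mem_right _ _ (Ideal.mem_span_singleton_self r), by ring⟩

theorem IsRegularMod.mul (hr : IsRegularMod A r) (hs : IsRegularMod A s) :
    IsRegularMod A (r * s) := fun t ht => hs t (hr _ (by rwa [← mul_assoc]))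

theorem IsRegularMod.one : IsRegularMod A 1 := fun t ht => by simpa using ht

theorem IsRegularMod.pow (hr : IsRegularMod A r) (n : ℕ) : IsRegularMod A (r ^ n) := by
  induction n with
  | zero => simpa using IsRegularMod.one
  | succ n ih => rw [pow_succ]; exact ih.mul hr

/-- If rt ≡ sw modulo A, regularity of s modulo r gives w ≡ rv, and cancelling r leaves t ≡ sv. -/
theorem IsRegularMod.swap (hr : IsRegularMod A r) (hs : IsRegularMod (A ⊔ Ideal.span {r}) s) :
    IsRegularMod (A ⊔ Ideal.span {s}) r := by
  intro t ht
  rw [mem_sup_span_singleton'] at ht ⊢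
  obtain ⟨w, hw⟩ := ht
  obtain ⟨v, hv⟩ := mem_sup_span_singleton'.1 <| hs w <| mem_sup_span_singleton'.2
    ⟨t, by rw [← neg_mem_iff]; convert! hw using 1; ring⟩
  refine ⟨v, hr _ ?_⟩
  have := A.add_mem hw (A.mul_mem_left s hv)
  convert! this using 1; ring

/-- Multiplication by p embeds R/(A + q) into R/(A + pq) with cokernel R/(A + p); an element regular
on both ends is regular in the middle. -/
theorem IsRegularMod.of_mul {p q : R} (hp : IsRegularMod A p)
    (hrp : IsRegularMod (A ⊔ Ideal.span {p}) r) (hrq : IsRegularMod (A ⊔ Ideal.span {q}) r) :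
    IsRegularMod (A ⊔ Ideal.span {p * q}) r := by
  intro t ht
  rw [mem_sup_span_singleton'] at ht ⊢
  obtain ⟨w, hw⟩ := ht
  obtain ⟨v, hv⟩ := mem_sup_span_singleton'.1 <| hrp t <| mem_sup_span_singleton'.2
    ⟨q * w, by convert! hw using 1; ring⟩
  have h1 : p * (r * v - q * w) ∈ A := by
    have := A.sub_mem hw (A.mul_mem_left r hv)
    convert! this using 1; ring
  obtain ⟨v', hv'⟩ := mem_sup_span_singleton'.1 <| hrq v <| mem_sup_span_singleton'.2 ⟨w, hp _ h1⟩
  refine ⟨v', ?_⟩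
  have := A.add_mem hv (A.mul_mem_left p hv')
  convert! this using 1; ring

theorem IsRegularMod.of_pow {p : R} (hp : IsRegularMod A p)
    (hr : IsRegularMod (A ⊔ Ideal.span {p}) r) (n : ℕ) :
    IsRegularMod (A ⊔ Ideal.span {p ^ n}) r := by
  induction n with
  | zero => intro t _; simp
  | succ n ih => rw [pow_succ']; exact hp.of_mul hr ih

end CommRing

/-! ### Depth and dimension: systems of parameters are regular sequences. -/

section IsLocalRing

variable {R : Type*} [CommRing R] [IsLocalRing R]

theorem HasRegularSeqMod.mono {n : ℕ} : ∀ {k : ℕ} {A : Ideal R}, HasRegularSeqMod n A → k ≤ n →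
    HasRegularSeqMod k A := by
  induction n with
  | zero => intro k A h hk; obtain rfl : k = 0 := by omega
            trivial
  | succ n ih =>
    intro k A h hk
    cases k with
    | zero => trivial
    | succ k =>
      obtain ⟨r, hr, h1, h2⟩ := h
      exact ⟨r, hr, h1, ih h2 (by omega)⟩

theorem hasRegularSeqMod_of_list : ∀ (rs : List R) (A : Ideal R),
    (∀ r ∈ rs, r ∈ maximalIdeal R) →
    (∀ i (h : i < rs.length), IsRegularMod (A ⊔ Ideal.ofList (rs.take i)) rs[i]) →
    HasRegularSeqMod rs.length A
  | [], _, _, _ => trivial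
  | r :: rs, A, hm, h => by
    refine ⟨r, hm r (by simp), by
      have := h 0 (by simp)
      rwa [List.take_zero, Ideal.ofList_nil, sup_bot_eq] at this, hasRegularSeqMod_of_list rs _
      (fun s hs => hm s (by simp [hs])) fun i hi => ?_⟩
    have := h (i + 1) (by simpa using hi)
    simpa [sup_assoc] using this

theorem hasRegularSeqMod_of_le_moduleDepth {n : ℕ} (h : (n : ℕ∞) ≤ moduleDepth R R) :
    HasRegularSeqMod n (⊥ : Ideal R) := by
  cases n with
  | zero => trivial
  | succ n =>
    have h' : (n : ℕ∞) < moduleDepth R R := lt_of_lt_of_le (by exact_mod_cast n.lt_succ_self) h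
    simp only [moduleDepth, lt_iSup_iff] at h'
    obtain ⟨rs, ⟨hm, hrs⟩, hn⟩ := h'
    refine (hasRegularSeqMod_of_list rs ⊥ hm fun i hi => ?_).mono
      (Nat.succ_le_of_lt (by exact_mod_cast hn))
    have := hrs.regular_mod_prev i hi
    have e : (Ideal.ofList (rs.take i) • ⊤ : Submodule R R) = Ideal.ofList (rs.take i) := by simp
    rw [e] at this
    rwa [bot_sup_eq, isRegularMod_iff_isSMulRegular]

variable [IsNoetherianRing R]

/-- If the maximal ideal consists of zerodivisors on a finite module, then it is an
annihilator. -/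
theorem exists_maximalIdeal_smul_eq_zero {M : Type*} [AddCommGroup M] [Module R M]
    [Module.Finite R M] (h : ∀ r ∈ maximalIdeal R, ¬ IsSMulRegular M r) :
    ∃ e : M, e ≠ 0 ∧ ∀ r ∈ maximalIdeal R, r • e = 0 := by
  obtain ⟨P, h, hP⟩ : ∃ P ∈ associatedPrimes R M, maximalIdeal R ≤ P :=
    ((maximalIdeal R).subset_union_prime_finite (associatedPrimes.finite ..) (f := id) 0 0
      fun _ h _ _ => h.1).1 <| by
        have := biUnion_associatedPrimes_eq_compl_regular R M
        simp only [id]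
        rw [this]
        exact h
  rw [AssociatedPrimes.mem_iff, isAssociatedPrime_iff] at h
  obtain ⟨prime, x, rfl⟩ := h
  refine ⟨x, fun h => prime.ne_top (by simp [h]), fun r hr => ?_⟩
  simpa [Submodule.mem_colon_singleton] using hP hr

/-- An element regular on the product of the R/Aᵢ is regular on each factor. If there were none, a
nonzero vector would be killed by the maximal ideal, although each factor has a regular element. -/
theorem exists_isRegularMod_of_forall {ι : Type*} [Finite ι] {A : ι → Ideal R}
    (h : ∀ i, HasRegularSeqMod 1 (A i)) : ∃ w ∈ maximalIdeal R, ∀ i, IsRegularMod (A i) w := by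
  by_contra! hc
  obtain ⟨e, he, hm⟩ := exists_maximalIdeal_smul_eq_zero (R := R)
      (M := ∀ i, R ⧸ A i) fun r hr hreg => by
    obtain ⟨i, hi⟩ := hc r hr
    classical
    refine hi (isRegularMod_iff_isSMulRegular.2 fun a b hab => ?_)
    have : r • Pi.single (M := fun i => R ⧸ A i) i a =
        r • Pi.single (M := fun i => R ⧸ A i) i b := by
      rw [← Pi.single_smul, ← Pi.single_smul]
      exact congrArg _ hab
    simpa using congrFun (hreg this) i
  refine he (funext fun i => ?_)
  obtain ⟨r, hr, hreg, -⟩ := h i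
  exact (isRegularMod_iff_isSMulRegular.1 hreg).right_eq_zero_of_smul (congrFun (hm r hr) i)

/-- The socles of R/(A + x) and R/(A + y) are both Ext¹(k, R/A), k being the residue field.
Explicitly, a socle element e modulo x is sent to the e' with ye ≡ xe' modulo A, so e vanishes when
e' does. -/
theorem HasRegularSeqMod.exchange_one {A : Ideal R} {x y : R}
    (hy : y ∈ maximalIdeal R) (hxA : IsRegularMod A x) (hyA : IsRegularMod A y)
    (h : HasRegularSeqMod 1 (A ⊔ Ideal.span {y})) : HasRegularSeqMod 1 (A ⊔ Ideal.span {x}) := by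
  obtain ⟨r, hr, hreg, -⟩ := h
  by_contra hc
  obtain ⟨e, he, hm⟩ := exists_maximalIdeal_smul_eq_zero (R := R)
    (M := R ⧸ (A ⊔ Ideal.span {x})) fun s hs hreg => hc
      ⟨s, hs, isRegularMod_iff_isSMulRegular.2 hreg, trivial⟩
  obtain ⟨e, rfl⟩ := Ideal.Quotient.mk_surjective e
  have hm' : ∀ s ∈ maximalIdeal R, s * e ∈ A ⊔ Ideal.span {x} := fun s hs =>
    Ideal.Quotient.eq_zero_iff_mem.1 (hm s hs)
  refine he (Ideal.Quotient.eq_zero_iff_mem.2 ?_)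
  obtain ⟨e', he'⟩ := mem_sup_span_singleton'.1 (hm' y hy)
  obtain ⟨f, hf⟩ := mem_sup_span_singleton'.1 (hm' r hr)
  obtain ⟨w, hw⟩ := mem_sup_span_singleton'.1 <| hreg e' <| mem_sup_span_singleton'.2 ⟨f, hxA _ <| by
    have := A.sub_mem (A.mul_mem_left y hf) (A.mul_mem_left r he')
    convert! this using 1; ring⟩
  refine mem_sup_span_singleton'.2 ⟨w, hyA _ ?_⟩
  have := A.add_mem he' (A.mul_mem_left x hw)
  convert! this using 1; ring

/-- Depth drops by one whichever regular element is divided out. An element w regular modulo A, A +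
(x) and A + (r) mediates between the given r and x: the induction hypothesis is applied once modulo
r and once modulo w. -/
theorem HasRegularSeqMod.sup_span {n : ℕ} : ∀ {A : Ideal R} {x : R}, HasRegularSeqMod (n + 1) A →
    x ∈ maximalIdeal R → IsRegularMod A x → HasRegularSeqMod n (A ⊔ Ideal.span {x}) := by
  induction n with
  | zero => intros; trivial
  | succ n ih =>
    intro A x hA hx hxA
    have hA1 : HasRegularSeqMod 1 A := hA.mono (by omega)
    obtain ⟨r, hr, hrA, h⟩ := hA
    have hx1 := (h.mono (show 1 ≤ n + 1 by omega)).exchange_one hr hxA hrA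
    obtain ⟨w, hw, hwA⟩ := exists_isRegularMod_of_forall
      (A := ![A, A ⊔ Ideal.span {x}, A ⊔ Ideal.span {r}]) (by
        intro i; fin_cases i
        exacts [hA1, hx1, h.mono (by omega)])
    have h0 : IsRegularMod A w := hwA 0
    have h1 : IsRegularMod (A ⊔ Ideal.span {x}) w := hwA 1
    have h2 : IsRegularMod (A ⊔ Ideal.span {r}) w := hwA 2
    have h3 := ih h hw h2
    rw [sup_right_comm] at h3
    have h4 := ih ⟨r, hr, hrA.swap h2, h3⟩ hx (hxA.swap h1)
    rw [sup_right_comm] at h4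
    exact ⟨w, hw, h1, h4⟩

/-- The depth of `R ⧸ A` is at most the dimension of each of its nonzero cyclic submodules. -/
theorem HasRegularSeqMod.le_ringKrullDim {n : ℕ} : ∀ {A B : Ideal R} {e : R}, HasRegularSeqMod n A →
    e ∉ A → (∀ t, t ∈ B ↔ t * e ∈ A) → (n : WithBot ℕ∞) ≤ ringKrullDim (R ⧸ B) := by
  induction n with
  | zero =>
    intro A B e _ he hB
    have : Nontrivial (R ⧸ B) := Ideal.Quotient.nontrivial_iff.2 <| (Ideal.ne_top_iff_one B).2
      fun h => he (by simpa using (hB 1).1 h)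
    exact_mod_cast ringKrullDim_nonneg_of_nontrivial
  | succ n ih =>
    rintro A B e ⟨r, hr, hrA, h⟩ he hB
    let N : Ideal R := A.colon (B : Set R)
    have hN : ∀ t, t ∈ N ↔ ∀ b ∈ B, t * b ∈ A := fun t => by
      simp [N, Submodule.mem_colon]
    have hAN : A ≤ N := fun t ht => (hN t).2 fun b _ => A.mul_mem_right _ ht
    -- If N ⊆ A + (r), regularity of r gives N ⊆ A + rN, so N ⊆ A by Nakayama, against e ∈ N.
    obtain ⟨e', he'N, he'⟩ : ∃ e' ∈ N, e' ∉ A ⊔ Ideal.span {r} := by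
      by_contra! hc
      refine he ?_
      have : N ≤ A := by
        refine Submodule.le_of_le_smul_of_le_jacobson_bot (I := maximalIdeal R)
          (IsNoetherian.noetherian N) (maximalIdeal_le_jacobson _) fun t ht => ?_
        obtain ⟨w, hw⟩ := mem_sup_span_singleton'.1 (hc t ht)
        refine Submodule.mem_sup.2 ⟨_, hw, r * w, ?_, by ring⟩
        refine Ideal.mul_mem_mul hr ((hN w).2 fun b hb => hrA _ ?_)
        have := A.sub_mem ((hN t).1 ht b hb) (A.mul_mem_right b hw)
        convert! this using 1; ring
      exact this ((hN e).2 fun b hb => by rw [mul_comm]; exact (hB b).1 hb)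
    have hdim := ih (B := (A ⊔ Ideal.span {r}).colon {e'}) h he' fun t => by
      simp [Submodule.mem_colon_singleton]
    have hle : B ≤ (A ⊔ Ideal.span {r}).colon {e'} := fun b hb => by
      rw [Submodule.mem_colon_singleton, smul_eq_mul, mul_comm]
      exact Ideal.mem_sup_left ((hN e').1 he'N b hb)
    -- The element r is regular on R/B and zero in the further quotient, so the dimension drops by
    -- at least one.
    have := ringKrullDim_succ_le_of_surjective (Ideal.Quotient.factor hle)
      (Ideal.Quotient.factor_surjective hle) (r := Ideal.Quotient.mk B r) ?_ ?_
    · refine le_trans ?_ this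
      push_cast
      gcongr
    · rw [mem_nonZeroDivisors_iff_right]
      intro t ht
      obtain ⟨t, rfl⟩ := Ideal.Quotient.mk_surjective t
      rw [← map_mul, Ideal.Quotient.eq_zero_iff_mem, hB] at ht
      rw [Ideal.Quotient.eq_zero_iff_mem, hB]
      exact hrA _ (by convert! ht using 1; ring)
    · rw [Ideal.Quotient.factor_mk, Ideal.Quotient.eq_zero_iff_mem, Submodule.mem_colon_singleton]
      exact Ideal.mul_mem_right _ _ (Ideal.mem_sup_right (Ideal.mem_span_singleton_self r))

/-- Krull's height theorem applied to the maximal ideal of R/B, minimal over the image of S. -/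
theorem ringKrullDim_quotient_le_card {B : Ideal R} (hB : B ≠ ⊤) {S : Finset R}
    (hSm : ∀ s ∈ S, s ∈ maximalIdeal R)
    (hS : maximalIdeal R ≤ (B ⊔ Ideal.span (S : Set R)).radical) :
    ringKrullDim (R ⧸ B) ≤ S.card := by
  classical
  have : Nontrivial (R ⧸ B) := Ideal.Quotient.nontrivial_iff.2 hB
  have : IsLocalRing (R ⧸ B) := IsLocalRing.of_surjective' _ Ideal.Quotient.mk_surjective
  have hcomap : (maximalIdeal (R ⧸ B)).comap (Ideal.Quotient.mk B) = maximalIdeal R :=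
    eq_maximalIdeal (Ideal.comap_isMaximal_of_surjective _ Ideal.Quotient.mk_surjective)
  rw [← maximalIdeal_height_eq_ringKrullDim]
  have hmin : maximalIdeal (R ⧸ B) ∈
      (Ideal.span ((S.image (Ideal.Quotient.mk B) : Finset (R ⧸ B)) : Set (R ⧸ B))).minimalPrimes := by
    refine ⟨⟨inferInstance, Ideal.span_le.2 fun s hs => ?_⟩, fun q ⟨hq, hSq⟩ _ => ?_⟩
    · obtain ⟨s', hs', rfl⟩ := Finset.mem_image.1 (Finset.mem_coe.1 hs)
      exact Ideal.mem_comap.1 (hcomap ▸ hSm s' hs')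
    · have hle : maximalIdeal R ≤ q.comap (Ideal.Quotient.mk B) := by
        refine hS.trans ((hq.comap _).radical_le_iff.2 (sup_le (fun b hb => ?_)
          (Ideal.span_le.2 fun s hs => ?_)))
        · rw [Ideal.mem_comap, Ideal.Quotient.eq_zero_iff_mem.2 hb]; exact q.zero_mem
        · exact hSq (Ideal.subset_span (Finset.mem_coe.2 (Finset.mem_image_of_mem _ hs)))
      intro t ht
      obtain ⟨t, rfl⟩ := Ideal.Quotient.mk_surjective t
      exact hle (hcomap ▸ Ideal.mem_comap.2 ht)
  have h1 := Ideal.height_le_card_of_mem_minimalPrimes_span_finset hmin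
  have h2 : (maximalIdeal (R ⧸ B)).height ≤ (S.card : ℕ∞) :=
    h1.trans (by exact_mod_cast Finset.card_image_le)
  exact_mod_cast h2

/-- If rt ∈ A but t ∉ A, then (A : t) contains A and r, so S bounds the dimension of R/(A : t) by a
number below n, against `HasRegularSeqMod.le_ringKrullDim`. -/
theorem HasRegularSeqMod.isRegularMod {n : ℕ} {A : Ideal R} {r : R} (h : HasRegularSeqMod n A)
    {S : Finset R} (hS : S.card < n) (hSm : ∀ s ∈ S, s ∈ maximalIdeal R)
    (hm : maximalIdeal R ≤ (A ⊔ Ideal.span {r} ⊔ Ideal.span (S : Set R)).radical) :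
    IsRegularMod A r := by
  intro t ht
  by_contra htA
  have h1 := h.le_ringKrullDim (B := A.colon {t}) htA fun t => by
      simp [Submodule.mem_colon_singleton]
  have h2 : A.colon {t} ≠ ⊤ := fun h => htA (by
    simpa [Submodule.mem_colon_singleton] using (Ideal.eq_top_iff_one _).1 h)
  have h3 := h1.trans (ringKrullDim_quotient_le_card h2 hSm (hm.trans (Ideal.radical_mono ?_)))
  · have : n ≤ S.card := by exact_mod_cast h3
    omega
  · gcongr
    refine sup_le (fun a ha => ?_) ((Ideal.span_singleton_le_iff_mem _).2 ?_)
    · rw [Submodule.mem_colon_singleton]; exact A.mul_mem_right _ ha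
    · rw [Submodule.mem_colon_singleton]; exact ht

end IsLocalRing

/-- In a local ring of depth at least three, three elements of the maximal ideal that generate an
ideal primary to it form a regular sequence. -/
theorem isRegularMod_of_radical_span_eq {R : Type*} [CommRing R] [IsLocalRing R]
    [IsNoetherianRing R] (h : HasRegularSeqMod 3 (⊥ : Ideal R)) {x y z : R}
    (hx : x ∈ maximalIdeal R) (hy : y ∈ maximalIdeal R) (hz : z ∈ maximalIdeal R)
    (hm : maximalIdeal R ≤ (Ideal.span {x, y, z}).radical) :
    IsRegularMod ⊥ x ∧ IsRegularMod (Ideal.span {x}) y ∧ IsRegularMod (Ideal.span {x, y}) z := by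
  classical
  have e2 : Ideal.span {x} ⊔ Ideal.span {y} = Ideal.span {x, y} := (Ideal.span_insert x {y}).symm
  have e3 : Ideal.span {x, y} ⊔ Ideal.span {z} = Ideal.span {x, y, z} := by
    rw [← e2, Ideal.span_insert x {y, z}, Ideal.span_insert y {z}, sup_assoc]
  have h1 : IsRegularMod ⊥ x := by
    refine h.isRegularMod (S := {y, z}) (lt_of_le_of_lt Finset.card_le_two (by norm_num))
      (by simpa using ⟨hy, hz⟩) ?_
    rwa [bot_sup_eq, Finset.coe_pair, ← Ideal.span_insert]
  have d1 := h.sup_span hx h1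
  rw [bot_sup_eq] at d1
  have h2 : IsRegularMod (Ideal.span {x}) y := by
    refine d1.isRegularMod (S := {z}) (by simp) (by simpa using hz) ?_
    rwa [e2, Finset.coe_singleton, e3]
  have d2 := d1.sup_span hy h2
  rw [e2] at d2
  refine ⟨h1, h2, d2.isRegularMod (S := ∅) (by simp) (by simp) ?_⟩
  rwa [e3, Finset.coe_empty, Ideal.span_empty, sup_bot_eq]

/-! ### Syzygies of monomials in a regular sequence. -/

section Syzygies

variable {S : Type*} [CommRing S] {Y Z : Submonoid S}

/-- One elimination step: P cancels, so p divides qt, and q is a nonzerodivisor modulo p. -/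
theorem exists_eq_mul_of_chain (hY : ∀ p ∈ Y, ∀ t, p * t = 0 → t = 0)
    (hZ : ∀ p ∈ Y, ∀ q ∈ Z, ∀ t, p ∣ q * t → p ∣ t) {P p q t : S} (w : S)
    (hP : P ∈ Y) (hp : p ∈ Y) (hq : q ∈ Z) (h : P * (q * t + p * w) = 0) : ∃ l, t = p * l :=
  hZ p hp q hq t ⟨-w, by linear_combination hY P hP _ h⟩

theorem syzygies_of_monomials (hY : ∀ p ∈ Y, ∀ t, p * t = 0 → t = 0)
    (hZ : ∀ p ∈ Y, ∀ q ∈ Z, ∀ t, p ∣ q * t → p ∣ t) {b c u v : S}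
    (hb : b ∈ Y) (hu : u ∈ Y) (hc : c ∈ Z) (hv : v ∈ Z) {t₀ t₁ t₂ : S}
    (E : t₀ * (v * c ^ 3) + t₁ * (u * b ^ 2 * c) + t₂ * (u * b ^ 3) = 0) :
    ∃ l₀ l₁, t₀ = u * b ^ 2 * l₀ ∧ t₁ = b * l₁ - v * c ^ 2 * l₀ ∧ t₂ = - c * l₁ := by
  have mY : ∀ {i j : ℕ}, u ^ i * b ^ j ∈ Y := mul_mem (pow_mem hu _) (pow_mem hb _)
  obtain ⟨l₀, rfl⟩ := exists_eq_mul_of_chain (P := 1) (p := u ^ 1 * b ^ 2) (q := v * c ^ 3) (t := t₀)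
    hY hZ (t₁ * c + t₂ * b) Y.one_mem mY (mul_mem hv (pow_mem hc _)) (by linear_combination E)
  obtain ⟨l₁, h₁⟩ := exists_eq_mul_of_chain (P := u ^ 1 * b ^ 2) (p := b) (q := c)
    (t := t₁ + v * c ^ 2 * l₀) hY hZ t₂ mY hb hc (by linear_combination E)
  obtain rfl : t₁ = b * l₁ - v * c ^ 2 * l₀ := by linear_combination h₁
  have h₂ := hY (u ^ 1 * b ^ 3) mY (t₂ + c * l₁) (by linear_combination E)
  exact ⟨l₀, l₁, by ring, rfl, by linear_combination h₂⟩

/-- Apart from d, the generators are monomials listed with c-exponent never increasing and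
b-exponent never decreasing, so each coefficient is determined up to a multiple of one new
parameter. The binomial d satisfies c²d = u f³ + g²h and b²d = v f²g + h³, whence the extra l₀ in t₈
and l₁ in t₁₀. -/
theorem syzygies_of_cubic_monomials (hY : ∀ p ∈ Y, ∀ t, p * t = 0 → t = 0)
    (hZ : ∀ p ∈ Y, ∀ q ∈ Z, ∀ t, p ∣ q * t → p ∣ t) {b c u v : S}
    (hb : b ∈ Y) (hu : u ∈ Y) (hc : c ∈ Z) (hv : v ∈ Z)
    {f g h d : S} (hf : f = v * c ^ 3) (hg : g = u * b ^ 2 * c) (hh : h = u * b ^ 3)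
    (hd : d = u * v ^ 3 * c ^ 7 + u ^ 3 * b ^ 7)
    {t₀ t₁ t₂ t₃ t₄ t₅ t₆ t₇ t₈ t₉ t₁₀ : S}
    (E : t₀ * f ^ 3 + t₁ * d + t₂ * (f ^ 2 * g) + t₃ * (f ^ 2 * h) + t₄ * (f * g ^ 2) +
      t₅ * (f * g * h) + t₆ * (f * h ^ 2) + t₇ * g ^ 3 + t₈ * (g ^ 2 * h) + t₉ * (g * h ^ 2) +
      t₁₀ * h ^ 3 = 0) :
    ∃ l₀ l₁ l₂ l₃ l₄ l₅ l₆ l₇ l₈ l₉, t₀ = u * l₀ ∧ t₁ = b ^ 2 * l₁ - c ^ 2 * l₀ ∧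
      t₂ = b * l₂ - v * l₁ ∧ t₃ = u * b * l₃ - c * l₂ ∧ t₄ = b * l₄ - c * v * l₃ ∧
      t₅ = b * l₅ - c * l₄ ∧ t₆ = u * l₆ - c * l₅ ∧ t₇ = b * l₇ - v * l₆ ∧
      t₈ = b * l₈ - c * l₇ + l₀ ∧ t₉ = b * l₉ - c * l₈ ∧ t₁₀ = - c * l₉ - l₁ := by
  subst hf hg hh hd
  have mY : ∀ {i j : ℕ}, u ^ i * b ^ j ∈ Y := mul_mem (pow_mem hu _) (pow_mem hb _)
  have mZ : ∀ {i j : ℕ}, v ^ i * c ^ j ∈ Z := mul_mem (pow_mem hv _) (pow_mem hc _)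
  obtain ⟨l₀, rfl⟩ := exists_eq_mul_of_chain (P := 1) (p := u) (q := v ^ 3 * c ^ 9) (t := t₀)
    hY hZ (t₁ * (v ^ 3 * c ^ 7 + u ^ 2 * b ^ 7) + t₂ * b ^ 2 * v ^ 2 * c ^ 7 +
      t₃ * b ^ 3 * v ^ 2 * c ^ 6 + t₄ * u * b ^ 4 * v * c ^ 5 + t₅ * u * b ^ 5 * v * c ^ 4 +
      t₆ * u * b ^ 6 * v * c ^ 3 + t₇ * u ^ 2 * b ^ 6 * c ^ 3 + t₈ * u ^ 2 * b ^ 7 * c ^ 2 +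
      t₉ * u ^ 2 * b ^ 8 * c + t₁₀ * u ^ 2 * b ^ 9) Y.one_mem hu mZ (by linear_combination E)
  obtain ⟨l₁, h₁⟩ := exists_eq_mul_of_chain (P := u) (p := b ^ 2) (q := v ^ 3 * c ^ 7)
    (t := t₁ + c ^ 2 * l₀) hY hZ ((t₁ + c ^ 2 * l₀) * u ^ 2 * b ^ 5 + t₂ * v ^ 2 * c ^ 7 +
      t₃ * b * v ^ 2 * c ^ 6 + t₄ * u * b ^ 2 * v * c ^ 5 + t₅ * u * b ^ 3 * v * c ^ 4 +
      t₆ * u * b ^ 4 * v * c ^ 3 + t₇ * u ^ 2 * b ^ 4 * c ^ 3 + (t₈ - l₀) * u ^ 2 * b ^ 5 * c ^ 2 +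
      t₉ * u ^ 2 * b ^ 6 * c + t₁₀ * u ^ 2 * b ^ 7) hu (pow_mem hb _) mZ (by linear_combination E)
  obtain rfl : t₁ = b ^ 2 * l₁ - c ^ 2 * l₀ := by linear_combination h₁
  obtain ⟨l₂, h₂⟩ := exists_eq_mul_of_chain (P := u ^ 1 * b ^ 2) (p := b) (q := v ^ 2 * c ^ 7)
    (t := t₂ + v * l₁) hY hZ (t₃ * v ^ 2 * c ^ 6 + t₄ * u * b * v * c ^ 5 +
      t₅ * u * b ^ 2 * v * c ^ 4 + t₆ * u * b ^ 3 * v * c ^ 3 + t₇ * u ^ 2 * b ^ 3 * c ^ 3 +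
      (t₈ - l₀) * u ^ 2 * b ^ 4 * c ^ 2 + t₉ * u ^ 2 * b ^ 5 * c + (t₁₀ + l₁) * u ^ 2 * b ^ 6)
    mY hb mZ (by linear_combination E)
  obtain rfl : t₂ = b * l₂ - v * l₁ := by linear_combination h₂
  obtain ⟨l₃, h₃⟩ := exists_eq_mul_of_chain (P := u ^ 1 * b ^ 3) (p := u * b) (q := v ^ 2 * c ^ 6)
    (t := t₃ + c * l₂) hY hZ (t₄ * v * c ^ 5 + t₅ * b * v * c ^ 4 + t₆ * b ^ 2 * v * c ^ 3 +
      t₇ * u * b ^ 2 * c ^ 3 + (t₈ - l₀) * u * b ^ 3 * c ^ 2 + t₉ * u * b ^ 4 * c +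
      (t₁₀ + l₁) * u * b ^ 5) mY (mul_mem hu hb) mZ (by linear_combination E)
  obtain rfl : t₃ = u * b * l₃ - c * l₂ := by linear_combination h₃
  obtain ⟨l₄, h₄⟩ := exists_eq_mul_of_chain (P := u ^ 2 * b ^ 4) (p := b) (q := v ^ 1 * c ^ 5)
    (t := t₄ + c * v * l₃) hY hZ (t₅ * v * c ^ 4 + t₆ * b * v * c ^ 3 + t₇ * u * b * c ^ 3 +
      (t₈ - l₀) * u * b ^ 2 * c ^ 2 + t₉ * u * b ^ 3 * c + (t₁₀ + l₁) * u * b ^ 4)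
    mY hb mZ (by linear_combination E)
  obtain rfl : t₄ = b * l₄ - c * v * l₃ := by linear_combination h₄
  obtain ⟨l₅, h₅⟩ := exists_eq_mul_of_chain (P := u ^ 2 * b ^ 5) (p := b) (q := v ^ 1 * c ^ 4)
    (t := t₅ + c * l₄) hY hZ (t₆ * v * c ^ 3 + t₇ * u * c ^ 3 + (t₈ - l₀) * u * b * c ^ 2 +
      t₉ * u * b ^ 2 * c + (t₁₀ + l₁) * u * b ^ 3) mY hb mZ (by linear_combination E)
  obtain rfl : t₅ = b * l₅ - c * l₄ := by linear_combination h₅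
  obtain ⟨l₆, h₆⟩ := exists_eq_mul_of_chain (P := u ^ 2 * b ^ 6) (p := u) (q := v ^ 1 * c ^ 3)
    (t := t₆ + c * l₅) hY hZ (t₇ * c ^ 3 + (t₈ - l₀) * b * c ^ 2 + t₉ * b ^ 2 * c +
      (t₁₀ + l₁) * b ^ 3) mY hu mZ (by linear_combination E)
  obtain rfl : t₆ = u * l₆ - c * l₅ := by linear_combination h₆
  obtain ⟨l₇, h₇⟩ := exists_eq_mul_of_chain (P := u ^ 3 * b ^ 6) (p := b) (q := c ^ 3)
    (t := t₇ + v * l₆) hY hZ ((t₈ - l₀) * c ^ 2 + t₉ * b * c + (t₁₀ + l₁) * b ^ 2)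
    mY hb (pow_mem hc _) (by linear_combination E)
  obtain rfl : t₇ = b * l₇ - v * l₆ := by linear_combination h₇
  obtain ⟨l₈, h₈⟩ := exists_eq_mul_of_chain (P := u ^ 3 * b ^ 7) (p := b) (q := c ^ 2)
    (t := t₈ - l₀ + c * l₇) hY hZ (t₉ * c + (t₁₀ + l₁) * b)
    mY hb (pow_mem hc _) (by linear_combination E)
  obtain rfl : t₈ = b * l₈ - c * l₇ + l₀ := by linear_combination h₈
  obtain ⟨l₉, h₉⟩ := exists_eq_mul_of_chain (P := u ^ 3 * b ^ 8) (p := b) (q := c)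
    (t := t₉ + c * l₈) hY hZ (t₁₀ + l₁) mY hb hc (by linear_combination E)
  obtain rfl : t₉ = b * l₉ - c * l₈ := by linear_combination h₉
  have h₁₀ := hY (u ^ 3 * b ^ 9) mY (t₁₀ + l₁ + c * l₉) (by linear_combination E)
  exact ⟨l₀, l₁, l₂, l₃, l₄, l₅, l₆, l₇, l₈, l₉, rfl, rfl, rfl, rfl, rfl, rfl, rfl, rfl, rfl, rfl,
    by linear_combination h₁₀⟩

end Syzygies

/-- The data of a matrix with rows `(a, b, c)` and `(u b², v c², a²)`, where `b`, `u` and `c`, `v`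
are taken from multiplicative sets of elements that behave like the powers of two members of a
regular sequence starting with `a`. -/
structure CyclicMatrix (R : Type*) [CommRing R] where
  (a b c u v : R)
  (Y Z : Submonoid R)
  b_mem : b ∈ Y
  u_mem : u ∈ Y
  c_mem : c ∈ Z
  v_mem : v ∈ Z
  regular_a : IsRegularMod ⊥ a
  regular_Y : ∀ p ∈ Y, IsRegularMod (Ideal.span {a}) p
  regular_Z : ∀ p ∈ Y, ∀ q ∈ Z, IsRegularMod (Ideal.span {a} ⊔ Ideal.span {p}) q

/-! ### The minors, the cube of their ideal and the extra generator. -/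

namespace CyclicMatrix

variable {R : Type*} [CommRing R] (D : CyclicMatrix R)

/-- The minor of the last two columns, in characteristic two. -/
def f : R := D.a ^ 2 * D.b + D.v * D.c ^ 3

/-- The minor of the outer columns, in characteristic two. -/
def g : R := D.a ^ 3 + D.u * D.b ^ 2 * D.c

/-- The minor of the first two columns, in characteristic two. -/
def h : R := D.u * D.b ^ 3 + D.v * D.a * D.c ^ 2

/-- The generator of the third symbolic power modulo the third power. -/
def d : R :=
  D.u * D.v * D.a ^ 4 * D.b ^ 2 * D.c + D.u * D.v ^ 2 * D.a ^ 2 * D.b * D.c ^ 4 +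
    D.u * D.v ^ 3 * D.c ^ 7 + D.v * D.a ^ 7 + D.u ^ 3 * D.b ^ 7 +
    D.u ^ 2 * D.v * D.a * D.b ^ 4 * D.c ^ 2

/-- The ideal of maximal minors. -/
def ideal : Ideal R := Ideal.span {D.f, D.g, D.h}

/-- The third symbolic power of the ideal of maximal minors. -/
def thirdSymbolic : Ideal R := D.ideal ^ 3 ⊔ Ideal.span {D.d}

/-- The annihilator of the third symbolic power modulo the third power. -/
def conductor : Ideal R := Ideal.span {D.a ^ 2, D.b ^ 2, D.c ^ 2, D.a * D.b * D.c}

theorem f_mem : D.f ∈ D.ideal := Ideal.subset_span (by simp)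

theorem g_mem : D.g ∈ D.ideal := Ideal.subset_span (by simp)

theorem h_mem : D.h ∈ D.ideal := Ideal.subset_span (by simp)

theorem mem_ideal_iff {t : R} :
    t ∈ D.ideal ↔ ∃ t₀ t₁ t₂, t₀ * D.f + t₁ * D.g + t₂ * D.h = t := by
  simp only [ideal, Ideal.mem_span_insert, Ideal.mem_span_singleton']
  constructor
  · rintro ⟨t₀, _, ⟨t₁, _, ⟨t₂, rfl⟩, rfl⟩, rfl⟩
    exact ⟨t₀, t₁, t₂, by ring⟩
  · rintro ⟨t₀, t₁, t₂, rfl⟩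
    exact ⟨t₀, _, ⟨t₁, _, ⟨t₂, rfl⟩, rfl⟩, by ring⟩

theorem mul_mul_mem_cube {p q r : R} (hp : p ∈ D.ideal) (hq : q ∈ D.ideal) (hr : r ∈ D.ideal) :
    p * q * r ∈ D.ideal ^ 3 := by
  rw [pow_succ, pow_two]
  exact Ideal.mul_mem_mul (Ideal.mul_mem_mul hp hq) hr

/-- The index 1 is left free for the coefficient of d in `mem_thirdSymbolic_iff`. -/
theorem mem_cube_iff {t : R} : t ∈ D.ideal ^ 3 ↔ ∃ t₀ t₂ t₃ t₄ t₅ t₆ t₇ t₈ t₉ t₁₀,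
    t₀ * (D.f ^ 3) + t₂ * (D.f ^ 2 * D.g) + t₃ * (D.f ^ 2 * D.h) +
      t₄ * (D.f * D.g ^ 2) + t₅ * (D.f * D.g * D.h) + t₆ * (D.f * D.h ^ 2) +
      t₇ * (D.g ^ 3) + t₈ * (D.g ^ 2 * D.h) + t₉ * (D.g * D.h ^ 2) + t₁₀ * (D.h ^ 3) = t := by
  constructor
  · intro ht
    have hle : D.ideal ^ 3 ≤ Ideal.span {D.f ^ 3, D.f ^ 2 * D.g, D.f ^ 2 * D.h, D.f * D.g ^ 2,
        D.f * D.g * D.h, D.f * D.h ^ 2,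
        D.g ^ 3, D.g ^ 2 * D.h, D.g * D.h ^ 2, D.h ^ 3} := by
      rw [pow_succ, pow_two, ideal, Ideal.span_mul_span', Ideal.span_mul_span', Ideal.span_le]
      rintro _ ⟨_, ⟨p, hp, q, hq, rfl⟩, r, hr, rfl⟩
      refine Ideal.subset_span ?_
      simp only [Set.mem_insert_iff, Set.mem_singleton_iff] at hp hq hr ⊢
      rcases hp with rfl | rfl | rfl <;> rcases hq with rfl | rfl | rfl <;>
        rcases hr with rfl | rfl | rfl <;> grind
    have := hle ht
    simp only [Ideal.mem_span_insert, Ideal.mem_span_singleton'] at this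
    obtain ⟨t₀, _, ⟨t₂, _, ⟨t₃, _, ⟨t₄, _, ⟨t₅, _, ⟨t₆, _, ⟨t₇, _, ⟨t₈, _, ⟨t₉, _, ⟨t₁₀, rfl⟩,
      rfl⟩, rfl⟩, rfl⟩, rfl⟩, rfl⟩, rfl⟩, rfl⟩, rfl⟩, rfl⟩ := this
    exact ⟨t₀, t₂, t₃, t₄, t₅, t₆, t₇, t₈, t₉, t₁₀, by ring⟩
  · rintro ⟨t₀, t₂, t₃, t₄, t₅, t₆, t₇, t₈, t₉, t₁₀, rfl⟩
    have key : ∀ p ∈ D.ideal, ∀ q ∈ D.ideal, ∀ r ∈ D.ideal, ∀ s w : R, p * q * r = w →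
        s * w ∈ D.ideal ^ 3 := fun p hp q hq r hr s w hw =>
      Ideal.mul_mem_left _ _ (hw ▸ D.mul_mul_mem_cube hp hq hr)
    have hf := D.f_mem
    have hg := D.g_mem
    have hh := D.h_mem
    refine add_mem (add_mem (add_mem (add_mem (add_mem (add_mem (add_mem (add_mem (add_mem
      (key _ hf _ hf _ hf _ _ ?_) (key _ hf _ hf _ hg _ _ ?_)) (key _ hf _ hf _ hh _ _ ?_))
      (key _ hf _ hg _ hg _ _ ?_)) (key _ hf _ hg _ hh _ _ ?_)) (key _ hf _ hh _ hh _ _ ?_))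
      (key _ hg _ hg _ hg _ _ ?_)) (key _ hg _ hg _ hh _ _ ?_)) (key _ hg _ hh _ hh _ _ ?_))
      (key _ hh _ hh _ hh _ _ ?_) <;> ring

theorem mem_thirdSymbolic_iff {t : R} : t ∈ D.thirdSymbolic ↔ ∃ t₀ t₁ t₂ t₃ t₄ t₅ t₆ t₇ t₈ t₉ t₁₀,
    t₀ * (D.f ^ 3) + t₁ * (D.d) + t₂ * (D.f ^ 2 * D.g) + t₃ * (D.f ^ 2 * D.h) +
      t₄ * (D.f * D.g ^ 2) + t₅ * (D.f * D.g * D.h) + t₆ * (D.f * D.h ^ 2) +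
      t₇ * (D.g ^ 3) + t₈ * (D.g ^ 2 * D.h) + t₉ * (D.g * D.h ^ 2) + t₁₀ * (D.h ^ 3) = t := by
  rw [thirdSymbolic, mem_sup_span_singleton']
  constructor
  · rintro ⟨t₁, h⟩
    obtain ⟨t₀, t₂, t₃, t₄, t₅, t₆, t₇, t₈, t₉, t₁₀, h⟩ := D.mem_cube_iff.1 h
    exact ⟨t₀, t₁, t₂, t₃, t₄, t₅, t₆, t₇, t₈, t₉, t₁₀, by linear_combination h⟩
  · rintro ⟨t₀, t₁, t₂, t₃, t₄, t₅, t₆, t₇, t₈, t₉, t₁₀, h⟩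
    exact ⟨t₁, D.mem_cube_iff.2 ⟨t₀, t₂, t₃, t₄, t₅, t₆, t₇, t₈, t₉, t₁₀, by
      linear_combination h⟩⟩

/-! ### Reduction modulo a. -/

section Reduction

theorem exists_eq_add_of_mk_eq {s t : R}
    (h : Ideal.Quotient.mk (Ideal.span {D.a}) s = Ideal.Quotient.mk (Ideal.span {D.a}) t) :
    ∃ e, s = t + D.a * e := by
  obtain ⟨e, he⟩ := Ideal.mem_span_singleton'.1 (Ideal.Quotient.eq.1 h)
  exact ⟨e, by linear_combination -he⟩

theorem mk_a : Ideal.Quotient.mk (Ideal.span {D.a}) D.a = 0 :=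
  Ideal.Quotient.eq_zero_iff_mem.2 (Ideal.mem_span_singleton_self _)

theorem eq_zero_of_mem_map_Y (p : R ⧸ Ideal.span {D.a})
    (hp : p ∈ D.Y.map (Ideal.Quotient.mk (Ideal.span {D.a}))) (t : R ⧸ Ideal.span {D.a})
    (h : p * t = 0) : t = 0 := by
  obtain ⟨p, hp, rfl⟩ := hp
  obtain ⟨t, rfl⟩ := Ideal.Quotient.mk_surjective t
  exact Ideal.Quotient.eq_zero_iff_mem.2
    (D.regular_Y p hp t (Ideal.Quotient.eq_zero_iff_mem.1 (by simpa using h)))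

theorem dvd_of_mem_map_Z (p : R ⧸ Ideal.span {D.a})
    (hp : p ∈ D.Y.map (Ideal.Quotient.mk (Ideal.span {D.a}))) (q : R ⧸ Ideal.span {D.a})
    (hq : q ∈ D.Z.map (Ideal.Quotient.mk (Ideal.span {D.a}))) (t : R ⧸ Ideal.span {D.a})
    (h : p ∣ q * t) : p ∣ t := by
  obtain ⟨p, hp, rfl⟩ := hp
  obtain ⟨q, hq, rfl⟩ := hq
  obtain ⟨t, rfl⟩ := Ideal.Quotient.mk_surjective t
  obtain ⟨w, hw⟩ := h
  obtain ⟨w, rfl⟩ := Ideal.Quotient.mk_surjective w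
  obtain ⟨w', hw'⟩ := mem_sup_span_singleton'.1 <| D.regular_Z p hp q hq t <|
    mem_sup_span_singleton'.2 ⟨w, Ideal.Quotient.eq.1 (by simpa using hw)⟩
  exact ⟨Ideal.Quotient.mk _ w', by simpa using Ideal.Quotient.eq.2 hw'⟩

theorem eq_of_a_mul_eq {s t : R} (h : D.a * s = D.a * t) : s = t := by
  rw [← sub_eq_zero, ← Ideal.mem_bot]
  exact D.regular_a _ (by rw [mul_sub, h, sub_self]; exact Ideal.zero_mem _)

end Reduction

/-! ### Relations in characteristic two, and regularity of a. -/

section CharTwo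

variable [CharP R 2]

/-- Each row of the matrix is a syzygy of its minors, by expanding a determinant with a repeated
row. Here and below, the factor of `h2` is half the defect of the identity over the integers. -/
theorem rel_top_row : D.a * D.f + D.b * D.g - D.c * D.h = 0 := by
  have h2 : (2 : R) = 0 := CharTwo.two_eq_zero
  simp only [f, g, h]
  linear_combination (D.a ^ 3 * D.b) * h2

theorem rel_bottom_row : D.u * D.b ^ 2 * D.f - D.v * D.c ^ 2 * D.g + D.a ^ 2 * D.h = 0 := by
  have h2 : (2 : R) = 0 := CharTwo.two_eq_zero
  simp only [f, g, h]
  linear_combination (D.a ^ 2 * D.b ^ 3 * D.u) * h2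

/-- This and the next three relations lift the syzygies modulo a that do not come from the top row.
Their coefficients at d are, up to sign, c², b², abc and a²: the generators of `conductor`. -/
theorem rel_c_sq : D.u * D.f ^ 3 - D.c ^ 2 * D.d + D.g ^ 2 * D.h = 0 := by
  have h2 : (2 : R) = 0 := CharTwo.two_eq_zero
  simp only [f, g, h, d]
  linear_combination (D.a ^ 6 * D.b ^ 3 * D.u + 2 * D.a ^ 4 * D.b ^ 2 * D.c ^ 3 * D.u * D.v +
    D.a ^ 2 * D.b * D.c ^ 6 * D.u * D.v ^ 2 + D.a ^ 3 * D.b ^ 5 * D.c * D.u ^ 2) * h2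

theorem rel_b_sq : D.b ^ 2 * D.d - D.v * (D.f ^ 2 * D.g) - D.h ^ 3 = 0 := by
  have h2 : (2 : R) = 0 := CharTwo.two_eq_zero
  simp only [f, g, h, d]
  linear_combination (-2 * D.a ^ 2 * D.b ^ 3 * D.c ^ 4 * D.u * D.v ^ 2 -
    D.a * D.b ^ 6 * D.c ^ 2 * D.u ^ 2 * D.v - D.a ^ 5 * D.b * D.c ^ 3 * D.v ^ 2 -
    D.a ^ 3 * D.c ^ 6 * D.v ^ 3) * h2

theorem rel_abc : D.u * D.b * (D.f ^ 2 * D.h) - D.c * D.v * (D.f * D.g ^ 2) +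
    D.a * (D.g * D.h ^ 2) + D.a * D.b * D.c * D.d = 0 := by
  have h2 : (2 : R) = 0 := CharTwo.two_eq_zero
  simp only [f, g, h, d]
  linear_combination (D.a ^ 4 * D.b ^ 6 * D.u ^ 2 + D.a ^ 5 * D.b ^ 3 * D.c ^ 2 * D.u * D.v +
    2 * D.a ^ 2 * D.b ^ 5 * D.c ^ 3 * D.u ^ 2 * D.v +
    D.a * D.b * D.c ^ 8 * D.u * D.v ^ 3 + D.a * D.b ^ 8 * D.c * D.u ^ 3 +
    D.a ^ 3 * D.b ^ 2 * D.c ^ 5 * D.u * D.v ^ 2) * h2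

theorem rel_a_sq : D.u * (D.f * D.h ^ 2) - D.v * D.g ^ 3 + D.a ^ 2 * D.d = 0 := by
  have h2 : (2 : R) = 0 := CharTwo.two_eq_zero
  simp only [f, g, h, d]
  linear_combination (D.a ^ 2 * D.b ^ 7 * D.u ^ 3 + D.a ^ 4 * D.b * D.c ^ 4 * D.u * D.v ^ 2 +
    D.a * D.b ^ 3 * D.c ^ 5 * D.u ^ 2 * D.v ^ 2 +
    D.a ^ 2 * D.c ^ 7 * D.u * D.v ^ 3 - D.a ^ 6 * D.b ^ 2 * D.c * D.u * D.v) * h2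

/-- Modulo a, the syzygies of f, g, h are generated by the two rows, which lift. Subtracting the
lifts leaves coefficients divisible by a, and a cancels. -/
theorem isRegularMod_ideal : IsRegularMod D.ideal D.a := by
  intro n hn
  obtain ⟨t₀, t₁, t₂, E⟩ := D.mem_ideal_iff.1 hn
  have ha := D.mk_a
  obtain ⟨l₀, l₁, h₀, h₁, h₂⟩ := syzygies_of_monomials D.eq_zero_of_mem_map_Y D.dvd_of_mem_map_Z
    (Submonoid.mem_map_of_mem _ D.b_mem) (Submonoid.mem_map_of_mem _ D.u_mem)
    (Submonoid.mem_map_of_mem _ D.c_mem) (Submonoid.mem_map_of_mem _ D.v_mem)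
    (t₀ := Ideal.Quotient.mk _ t₀) (t₁ := Ideal.Quotient.mk _ t₁) (t₂ := Ideal.Quotient.mk _ t₂) (by
      simpa [f, g, h, ha] using congrArg (Ideal.Quotient.mk (Ideal.span {D.a})) E)
  obtain ⟨l₀, rfl⟩ := Ideal.Quotient.mk_surjective l₀
  obtain ⟨l₁, rfl⟩ := Ideal.Quotient.mk_surjective l₁
  obtain ⟨e₀, rfl⟩ := D.exists_eq_add_of_mk_eq (s := t₀) (t := D.u * D.b ^ 2 * l₀) (by
    rw [h₀]; simp)
  obtain ⟨e₁, rfl⟩ := D.exists_eq_add_of_mk_eq (s := t₁) (t := D.b * l₁ - D.v * D.c ^ 2 * l₀) (by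
    rw [h₁]; simp)
  obtain ⟨e₂, rfl⟩ := D.exists_eq_add_of_mk_eq (s := t₂) (t := - D.c * l₁) (by
    rw [h₂]; simp)
  refine D.mem_ideal_iff.2 ⟨e₀ - l₁, e₁, e₂ - D.a * l₀, D.eq_of_a_mul_eq ?_⟩
  linear_combination E - l₁ * D.rel_top_row - l₀ * D.rel_bottom_row

/-- Subtracting the lifted syzygies makes every coefficient divisible by a, which then cancels. The
last clause records that, beyond a·e₁, the coefficient of d only involves a², b², c² and abc. -/
theorem exists_division {n t₀ t₁ t₂ t₃ t₄ t₅ t₆ t₇ t₈ t₉ t₁₀ : R}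
    (E : t₀ * (D.f ^ 3) + t₁ * (D.d) + t₂ * (D.f ^ 2 * D.g) + t₃ * (D.f ^ 2 * D.h) +
      t₄ * (D.f * D.g ^ 2) + t₅ * (D.f * D.g * D.h) + t₆ * (D.f * D.h ^ 2) +
      t₇ * (D.g ^ 3) + t₈ * (D.g ^ 2 * D.h) + t₉ * (D.g * D.h ^ 2) + t₁₀ * (D.h ^ 3) = D.a * n) :
    ∃ e₀ e₁ e₂ e₃ e₄ e₅ e₆ e₇ e₈ e₉ e₁₀,
      e₀ * (D.f ^ 3) + e₁ * (D.d) + e₂ * (D.f ^ 2 * D.g) + e₃ * (D.f ^ 2 * D.h) +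
      e₄ * (D.f * D.g ^ 2) + e₅ * (D.f * D.g * D.h) + e₆ * (D.f * D.h ^ 2) +
      e₇ * (D.g ^ 3) + e₈ * (D.g ^ 2 * D.h) + e₉ * (D.g * D.h ^ 2) + e₁₀ * (D.h ^ 3) = n ∧
      t₁ - D.a * e₁ ∈ D.conductor := by
  have ha := D.mk_a
  obtain ⟨l₀, l₁, l₂, l₃, l₄, l₅, l₆, l₇, l₈, l₉, h₀, h₁, h₂, h₃, h₄, h₅, h₆, h₇, h₈, h₉, h₁₀⟩ :=
    syzygies_of_cubic_monomials D.eq_zero_of_mem_map_Y D.dvd_of_mem_map_Z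
    (Submonoid.mem_map_of_mem _ D.b_mem) (Submonoid.mem_map_of_mem _ D.u_mem)
    (Submonoid.mem_map_of_mem _ D.c_mem) (Submonoid.mem_map_of_mem _ D.v_mem)
    (f := Ideal.Quotient.mk _ D.f) (g := Ideal.Quotient.mk _ D.g) (h := Ideal.Quotient.mk _ D.h)
    (d := Ideal.Quotient.mk _ D.d)
    (by simp [f, ha]) (by simp [g, ha]) (by simp [h, ha]) (by simp [d, ha])
    (t₀ := Ideal.Quotient.mk _ t₀)
    (t₁ := Ideal.Quotient.mk _ t₁)
    (t₂ := Ideal.Quotient.mk _ t₂)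
    (t₃ := Ideal.Quotient.mk _ t₃)
    (t₄ := Ideal.Quotient.mk _ t₄)
    (t₅ := Ideal.Quotient.mk _ t₅)
    (t₆ := Ideal.Quotient.mk _ t₆)
    (t₇ := Ideal.Quotient.mk _ t₇)
    (t₈ := Ideal.Quotient.mk _ t₈)
    (t₉ := Ideal.Quotient.mk _ t₉)
    (t₁₀ := Ideal.Quotient.mk _ t₁₀)
    (by simpa [ha] using congrArg (Ideal.Quotient.mk (Ideal.span {D.a})) E)
  obtain ⟨l₀, rfl⟩ := Ideal.Quotient.mk_surjective l₀
  obtain ⟨l₁, rfl⟩ := Ideal.Quotient.mk_surjective l₁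
  obtain ⟨l₂, rfl⟩ := Ideal.Quotient.mk_surjective l₂
  obtain ⟨l₃, rfl⟩ := Ideal.Quotient.mk_surjective l₃
  obtain ⟨l₄, rfl⟩ := Ideal.Quotient.mk_surjective l₄
  obtain ⟨l₅, rfl⟩ := Ideal.Quotient.mk_surjective l₅
  obtain ⟨l₆, rfl⟩ := Ideal.Quotient.mk_surjective l₆
  obtain ⟨l₇, rfl⟩ := Ideal.Quotient.mk_surjective l₇
  obtain ⟨l₈, rfl⟩ := Ideal.Quotient.mk_surjective l₈
  obtain ⟨l₉, rfl⟩ := Ideal.Quotient.mk_surjective l₉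
  obtain ⟨e₀, rfl⟩ := D.exists_eq_add_of_mk_eq (s := t₀) (t := D.u * l₀) (by
    rw [h₀]; simp)
  obtain ⟨e₁, rfl⟩ := D.exists_eq_add_of_mk_eq (s := t₁) (t := D.b ^ 2 * l₁ - D.c ^ 2 * l₀) (by
    rw [h₁]; simp)
  obtain ⟨e₂, rfl⟩ := D.exists_eq_add_of_mk_eq (s := t₂) (t := D.b * l₂ - D.v * l₁) (by
    rw [h₂]; simp)
  obtain ⟨e₃, rfl⟩ := D.exists_eq_add_of_mk_eq (s := t₃) (t := D.u * D.b * l₃ - D.c * l₂) (by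
    rw [h₃]; simp)
  obtain ⟨e₄, rfl⟩ := D.exists_eq_add_of_mk_eq (s := t₄) (t := D.b * l₄ - D.c * D.v * l₃) (by
    rw [h₄]; simp)
  obtain ⟨e₅, rfl⟩ := D.exists_eq_add_of_mk_eq (s := t₅) (t := D.b * l₅ - D.c * l₄) (by
    rw [h₅]; simp)
  obtain ⟨e₆, rfl⟩ := D.exists_eq_add_of_mk_eq (s := t₆) (t := D.u * l₆ - D.c * l₅) (by
    rw [h₆]; simp)
  obtain ⟨e₇, rfl⟩ := D.exists_eq_add_of_mk_eq (s := t₇) (t := D.b * l₇ - D.v * l₆) (by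
    rw [h₇]; simp)
  obtain ⟨e₈, rfl⟩ := D.exists_eq_add_of_mk_eq (s := t₈) (t := D.b * l₈ - D.c * l₇ + l₀) (by
    rw [h₈]; simp)
  obtain ⟨e₉, rfl⟩ := D.exists_eq_add_of_mk_eq (s := t₉) (t := D.b * l₉ - D.c * l₈) (by
    rw [h₉]; simp)
  obtain ⟨e₁₀, rfl⟩ := D.exists_eq_add_of_mk_eq (s := t₁₀) (t := - D.c * l₉ - l₁) (by
    rw [h₁₀]; simp)
  -- The corrections to the eᵢ are the terms of the lifted relations that carry a factor a, divided
  -- by a.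
  refine ⟨e₀ - l₂, e₁ - D.b * D.c * l₃ - D.a * l₆, e₂ - l₄, e₃ - l₅,
    e₄ - l₇, e₅ - l₈, e₆ - l₉, e₇, e₈, e₉ - l₃, e₁₀, D.eq_of_a_mul_eq ?_, ?_⟩
  · linear_combination E - l₀ * D.rel_c_sq - l₁ * D.rel_b_sq - l₃ * D.rel_abc - l₆ * D.rel_a_sq -
      (l₂ * D.f ^ 2 + l₄ * D.f * D.g + l₅ * D.f * D.h + l₇ * D.g ^ 2 + l₈ * D.g * D.h +
        l₉ * D.h ^ 2) * D.rel_top_row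
  · simp only [conductor, Ideal.mem_span_insert, Ideal.mem_span_singleton']
    exact ⟨l₆, _, ⟨l₁, _, ⟨-l₀, _, ⟨l₃, rfl⟩, rfl⟩, rfl⟩, by ring⟩

theorem isRegularMod_thirdSymbolic : IsRegularMod D.thirdSymbolic D.a := by
  intro n hn
  obtain ⟨t₀, t₁, t₂, t₃, t₄, t₅, t₆, t₇, t₈, t₉, t₁₀, E⟩ := D.mem_thirdSymbolic_iff.1 hn
  obtain ⟨e₀, e₁, e₂, e₃, e₄, e₅, e₆, e₇, e₈, e₉, e₁₀, E', -⟩ := D.exists_division E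
  exact D.mem_thirdSymbolic_iff.2 ⟨_, _, _, _, _, _, _, _, _, _, _, E'⟩

theorem conductor_mul_d_mem {t : R} (ht : t ∈ D.conductor) : t * D.d ∈ D.ideal ^ 3 := by
  simp only [conductor, Ideal.mem_span_insert, Ideal.mem_span_singleton'] at ht
  obtain ⟨l₆, _, ⟨l₁, _, ⟨l₀, _, ⟨l₃, rfl⟩, rfl⟩, rfl⟩, rfl⟩ := ht
  refine D.mem_cube_iff.2 ⟨l₀ * D.u, l₁ * D.v, - l₃ * D.u * D.b, l₃ * D.c * D.v, 0, - l₆ * D.u,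
    l₆ * D.v, l₀, - l₃ * D.a, l₁, ?_⟩
  linear_combination l₀ * D.rel_c_sq - l₁ * D.rel_b_sq - l₃ * D.rel_abc - l₆ * D.rel_a_sq

/-- A relation with value 0 = a·0 can be divided by a and again has value 0. Two divisions place t
in the conductor up to a multiple of a², which is itself in the conductor. -/
theorem mul_d_mem_cube_iff {t : R} : t * D.d ∈ D.ideal ^ 3 ↔ t ∈ D.conductor := by
  refine ⟨fun ht => ?_, D.conductor_mul_d_mem⟩
  obtain ⟨t₀, t₂, t₃, t₄, t₅, t₆, t₇, t₈, t₉, t₁₀, E⟩ := D.mem_cube_iff.1 ht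
  obtain ⟨e₀, e₁, e₂, e₃, e₄, e₅, e₆, e₇, e₈, e₉, e₁₀, E', h⟩ := D.exists_division
    (n := 0) (t₀ := t₀) (t₁ := -t)
    (t₂ := t₂) (t₃ := t₃) (t₄ := t₄) (t₅ := t₅) (t₆ := t₆) (t₇ := t₇) (t₈ := t₈) (t₉ := t₉)
    (t₁₀ := t₁₀) (by linear_combination E)
  obtain ⟨-, f₁, -, -, -, -, -, -, -, -, -, -, h'⟩ := D.exists_division (n := 0)
    (E'.trans (mul_zero _).symm)
  have ha : D.a ^ 2 ∈ D.conductor := Ideal.subset_span (by simp)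
  have := add_mem (add_mem h (D.conductor.mul_mem_left D.a h')) (D.conductor.mul_mem_left f₁ ha)
  rw [← neg_mem_iff]
  convert! this using 1
  ring

end CharTwo

end CyclicMatrix

/-! ### Lengths of quotients by powers of parameters. -/

section Length

variable {R : Type*} [CommRing R]

/-- Exact sequence 0 → R/(L : w) → R/L → R/(L + w) → 0, the first map being multiplication by w. -/
theorem length_quotient_eq_add (L : Ideal R) (w : R) :
    Module.length R (R ⧸ L) =
      Module.length R (R ⧸ L ⊔ Ideal.span {w}) + Module.length R (R ⧸ L.colon {w}) := by
  have hw : L.colon {w} = Submodule.comap (LinearMap.mulRight R w) L := by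
    ext t
    simp [Submodule.mem_colon_singleton]
  rw [hw, add_comm]
  refine Module.length_eq_add_of_exact
    (Submodule.mapQ (Submodule.comap (LinearMap.mulRight R w) L) L (LinearMap.mulRight R w) le_rfl)
    (Submodule.factor (le_sup_left : L ≤ L ⊔ Ideal.span {w})) ?_ (Submodule.factor_surjective _) ?_
  · rw [← LinearMap.ker_eq_bot, Submodule.ker_mapQ, Submodule.mkQ_map_self]
  · intro t
    obtain ⟨t, rfl⟩ := Submodule.mkQ_surjective _ t
    have h1 : Submodule.factor (le_sup_left : L ≤ L ⊔ Ideal.span {w}) (L.mkQ t) = 0 ↔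
        t ∈ L ⊔ Ideal.span {w} := Submodule.Quotient.mk_eq_zero _
    rw [h1, mem_sup_span_singleton']
    constructor
    · rintro ⟨s, hs⟩
      refine ⟨Submodule.Quotient.mk s, ((Submodule.Quotient.eq _).2 ?_).symm⟩
      simpa [mul_comm] using hs
    · rintro ⟨s, hs⟩
      obtain ⟨s, rfl⟩ := Submodule.mkQ_surjective _ s
      exact ⟨s, by simpa [mul_comm] using (Submodule.Quotient.eq _).1 hs.symm⟩

theorem quotientLength_sup_span (L : Ideal R) (w : R) :
    quotientLength (L ⊔ Ideal.span {w}) L = Module.length R (R ⧸ L.colon {w}) := by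
  let φ : R →ₗ[R] (L ⊔ Ideal.span {w} : Ideal R) :=
    LinearMap.toSpanSingleton R _ ⟨w, Ideal.mem_sup_right (Ideal.mem_span_singleton_self w)⟩
  let ψ := (Submodule.submoduleOf L (L ⊔ Ideal.span {w})).mkQ ∘ₗ φ
  have hker : L.colon {w} = LinearMap.ker ψ := by
    ext t
    rw [Submodule.mem_colon_singleton, LinearMap.mem_ker]
    exact (Submodule.Quotient.mk_eq_zero (Submodule.submoduleOf L (L ⊔ Ideal.span {w}))
      (x := φ t)).symm
  have hsurj : Function.Surjective ψ := by
    intro t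
    obtain ⟨⟨t, ht⟩, rfl⟩ := Submodule.mkQ_surjective _ t
    obtain ⟨s, hs⟩ := mem_sup_span_singleton'.1 ht
    refine ⟨s, ((Submodule.Quotient.eq _).2 ?_).symm⟩
    change t - s * w ∈ L
    rwa [mul_comm]
  rw [hker]
  exact (LinearMap.quotKerEquivOfSurjective ψ hsurj).length_eq.symm

variable {L : Ideal R} {p q : R}

theorem IsRegularMod.mul_mem_sup_iff (hp : IsRegularMod L p) {t : R} :
    p * t ∈ L ⊔ Ideal.span {p * q} ↔ t ∈ L ⊔ Ideal.span {q} := by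
  rw [mem_sup_span_singleton', mem_sup_span_singleton']
  exact exists_congr fun w => ⟨fun h => hp _ (by convert! h using 1; ring), fun h => by
    have := L.mul_mem_left p h
    convert! this using 1; ring⟩

theorem IsRegularMod.length_quotient_mul (hp : IsRegularMod L p) :
    Module.length R (R ⧸ L ⊔ Ideal.span {p * q}) =
      Module.length R (R ⧸ L ⊔ Ideal.span {p}) + Module.length R (R ⧸ L ⊔ Ideal.span {q}) := by
  have h1 : L ⊔ Ideal.span {p * q} ⊔ Ideal.span {p} = L ⊔ Ideal.span {p} := by
    rw [sup_assoc, sup_eq_right.2 (Ideal.span_singleton_le_span_singleton.2 (Dvd.intro q rfl))]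
  have h2 : (L ⊔ Ideal.span {p * q}).colon {p} = L ⊔ Ideal.span {q} := by
    ext t
    rw [Submodule.mem_colon_singleton, smul_eq_mul, mul_comm t p, hp.mul_mem_sup_iff]
  rw [length_quotient_eq_add (L ⊔ Ideal.span {p * q}) p, h1, h2]

theorem IsRegularMod.length_quotient_pow (hp : IsRegularMod L p) (n : ℕ) :
    Module.length R (R ⧸ L ⊔ Ideal.span {p ^ n}) =
      n * Module.length R (R ⧸ L ⊔ Ideal.span {p}) := by
  induction n with
  | zero =>
    have : Subsingleton (R ⧸ L ⊔ Ideal.span {p ^ 0}) := by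
      rw [Ideal.Quotient.subsingleton_iff]; simp
    rw [Module.length_eq_zero]; simp
  | succ n ih =>
    rw [pow_succ', hp.length_quotient_mul, ih]
    push_cast
    ring

/-- Regularity of y on R itself allows x and y to be interchanged, so that both can be raised to
powers in turn. -/
theorem isRegularMod_span_pow_pow {x y z : R} (hx : IsRegularMod ⊥ x)
    (hxy : IsRegularMod (Ideal.span {x}) y) (hz : IsRegularMod (Ideal.span {x, y}) z)
    (hy : IsRegularMod ⊥ y) (i j : ℕ) : IsRegularMod (Ideal.span {x ^ i, y ^ j}) z := by
  rw [← bot_sup_eq (Ideal.span {x})] at hxy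
  have h1 : IsRegularMod (Ideal.span {y ^ j}) x := by
    simpa only [bot_sup_eq] using hy.of_pow (hx.swap hxy) j
  rw [Ideal.span_insert] at hz
  rw [bot_sup_eq] at hxy
  have h2 := hxy.of_pow hz j
  rw [sup_comm] at h2
  rw [Ideal.span_insert, sup_comm]
  exact h1.of_pow h2 i

/-- Each of `x`, `y`, `z` is a nonzerodivisor modulo any powers of the two others. -/
structure IsPowerRegular (x y z : R) : Prop where
  left : ∀ j k, IsRegularMod (Ideal.span {y ^ j, z ^ k}) x
  middle : ∀ i k, IsRegularMod (Ideal.span {x ^ i, z ^ k}) y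
  right : ∀ i j, IsRegularMod (Ideal.span {x ^ i, y ^ j}) z

theorem span_triple_eq_sup₁ (x y z : R) :
    Ideal.span {x, y, z} = Ideal.span {y, z} ⊔ Ideal.span {x} := by
  rw [Ideal.span_insert, sup_comm]

theorem span_triple_eq_sup₂ (x y z : R) :
    Ideal.span {x, y, z} = Ideal.span {x, z} ⊔ Ideal.span {y} := by
  rw [Set.insert_comm, span_triple_eq_sup₁]

theorem span_triple_eq_sup₃ (x y z : R) :
    Ideal.span {x, y, z} = Ideal.span {x, y} ⊔ Ideal.span {z} := by
  rw [Set.pair_comm, span_triple_eq_sup₂]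

namespace IsPowerRegular

variable {x y z : R}

theorem length_quotient_span_pow (H : IsPowerRegular x y z) (i j k : ℕ) :
    Module.length R (R ⧸ Ideal.span {x ^ i, y ^ j, z ^ k}) =
      i * j * k * Module.length R (R ⧸ Ideal.span {x, y, z}) := by
  have h1 := (H.left j k).length_quotient_pow i
  have h2 := (H.middle 1 k).length_quotient_pow j
  have h3 := (H.right 1 1).length_quotient_pow k
  rw [← span_triple_eq_sup₁, ← span_triple_eq_sup₁] at h1
  rw [← span_triple_eq_sup₂, ← span_triple_eq_sup₂, pow_one] at h2
  rw [← span_triple_eq_sup₃, ← span_triple_eq_sup₃, pow_one, pow_one] at h3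
  rw [h1, h2, h3]
  ring

theorem mul_mem_span_sq_iff (H : IsPowerRegular x y z) (i j k : ℕ) {t : R} :
    t * (x ^ i * y ^ j * z ^ k) ∈ Ideal.span {(x ^ i) ^ 2, (y ^ j) ^ 2, (z ^ k) ^ 2} ↔
      t ∈ Ideal.span {x ^ i, y ^ j, z ^ k} := by
  rw [show t * (x ^ i * y ^ j * z ^ k) = x ^ i * (y ^ j * (z ^ k * t)) by ring,
    span_triple_eq_sup₁, pow_two (x ^ i), ← pow_mul y, ← pow_mul z,
    ((H.left _ _).pow i).mul_mem_sup_iff, ← span_triple_eq_sup₁, span_triple_eq_sup₂, pow_mul y,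
    pow_two (y ^ j), ((H.middle _ _).pow j).mul_mem_sup_iff, ← span_triple_eq_sup₂,
    span_triple_eq_sup₃, pow_mul z, pow_two (z ^ k), ((H.right _ _).pow k).mul_mem_sup_iff,
    ← span_triple_eq_sup₃]

/-- The quotient by the three squares has length 8ℓ, with ℓ the length modulo the three elements.
Their product generates in it a copy of the quotient by the elements themselves, of length ℓ. -/
theorem length_quotient_conductor (H : IsPowerRegular x y z) (i j k : ℕ) :
    Module.length R (R ⧸ Ideal.span {(x ^ i) ^ 2, (y ^ j) ^ 2, (z ^ k) ^ 2,
      x ^ i * y ^ j * z ^ k}) = 7 * Module.length R (R ⧸ Ideal.span {x ^ i, y ^ j, z ^ k}) := by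
  have h := length_quotient_eq_add (Ideal.span {(x ^ i) ^ 2, (y ^ j) ^ 2, (z ^ k) ^ 2})
    (x ^ i * y ^ j * z ^ k)
  have h1 : (Ideal.span {(x ^ i) ^ 2, (y ^ j) ^ 2, (z ^ k) ^ 2}).colon {x ^ i * y ^ j * z ^ k} =
      Ideal.span {x ^ i, y ^ j, z ^ k} := by
    ext t
    rw [Submodule.mem_colon_singleton, smul_eq_mul, H.mul_mem_span_sq_iff]
  have h2 : Ideal.span {(x ^ i) ^ 2, (y ^ j) ^ 2, (z ^ k) ^ 2} ⊔
      Ideal.span {x ^ i * y ^ j * z ^ k} =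
      Ideal.span {(x ^ i) ^ 2, (y ^ j) ^ 2, (z ^ k) ^ 2, x ^ i * y ^ j * z ^ k} := by
    rw [← Ideal.span_union]
    congr 1
    ext t
    simp
    tauto
  have h3 : Module.length R (R ⧸ Ideal.span {(x ^ i) ^ 2, (y ^ j) ^ 2, (z ^ k) ^ 2}) =
      8 * Module.length R (R ⧸ Ideal.span {x ^ i, y ^ j, z ^ k}) := by
    rw [← pow_mul, ← pow_mul, ← pow_mul, H.length_quotient_span_pow, H.length_quotient_span_pow]
    push_cast
    ring
  rw [h1, h2, h3] at h
  have hle : Ideal.span {(x ^ i) ^ 2, (y ^ j) ^ 2, (z ^ k) ^ 2, x ^ i * y ^ j * z ^ k} ≤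
      Ideal.span {x ^ i, y ^ j, z ^ k} := by
    rw [Ideal.span_le]
    have mx : x ^ i ∈ Ideal.span {x ^ i, y ^ j, z ^ k} := Ideal.subset_span (by simp)
    have my : y ^ j ∈ Ideal.span {x ^ i, y ^ j, z ^ k} := Ideal.subset_span (by simp)
    have mz : z ^ k ∈ Ideal.span {x ^ i, y ^ j, z ^ k} := Ideal.subset_span (by simp)
    rintro t (rfl | rfl | rfl | rfl)
    exacts [Ideal.pow_mem_of_mem _ mx 2 two_pos, Ideal.pow_mem_of_mem _ my 2 two_pos,
      Ideal.pow_mem_of_mem _ mz 2 two_pos, Ideal.mul_mem_left _ _ mz]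
  have hlen := Module.length_le_of_surjective (Submodule.factor hle) (Submodule.factor_surjective hle)
  -- Cancelling ℓ in `ℕ∞` needs ℓ finite; if ℓ is infinite, the surjection makes both sides
  -- infinite.
  by_cases htop : Module.length R (R ⧸ Ideal.span {x ^ i, y ^ j, z ^ k}) = ⊤
  · rw [htop] at hlen ⊢
    rw [top_le_iff.1 hlen]
    rfl
  · refine (ENat.add_left_injective_of_ne_top htop ?_).symm
    dsimp only
    rw [← h]
    ring

end IsPowerRegular

end Length

/-! ### Symbolic powers through torsion, and positive depth. -/

/-- If `x` is a parameter modulo `I` and a nonzerodivisor modulo both `I` and `J`, where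
`J / I ^ n` is the `x`-power torsion, then `J` is the symbolic power. -/
theorem symbolicPower_eq_of_isRegularMod {R : Type*} [CommRing R] [IsLocalRing R]
    [IsNoetherianRing R] {I J : Ideal R} {n : ℕ} {x : R} (hx : x ∈ maximalIdeal R)
    (hI : IsRegularMod I x) (hrad : maximalIdeal R ≤ (I ⊔ Ideal.span {x}).radical)
    (hle : I ^ n ≤ J) (hJ : IsRegularMod J x) (htor : ∀ t ∈ J, ∃ k : ℕ, x ^ k * t ∈ I ^ n) :
    symbolicPower I n = J := by
  have hxp : ∀ p ∈ I.minimalPrimes, x ∉ p := fun p hp hxp => by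
    obtain ⟨y, hy, hxy⟩ := Ideal.exists_mul_mem_of_mem_minimalPrimes hp hxp
    exact hy (hI y hxy)
  refine le_antisymm (fun t ht => ?_) fun t ht => ?_
  -- Every prime P ⊇ (I^n : t) contains x. Take a minimal prime p ⊆ P of I: P = p is excluded by t ∈
  -- I^n R_p, and otherwise P is maximal because R/p has dimension at most 1.
  · have hmem : x ∈ ((I ^ n).colon {t}).radical := by
      rw [Ideal.radical_eq_sInf, Ideal.mem_sInf]
      rintro P ⟨hTP, hP⟩
      have hIP : I ≤ P := hP.le_of_pow_le (n := n) fun s hs => hTP <| by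
        rw [Submodule.mem_colon_singleton]; exact Ideal.mul_mem_right _ _ hs
      obtain ⟨p, hp, hpP⟩ := Ideal.exists_minimalPrimes_le hIP
      have hpp : p.IsPrime := hp.1.1
      rcases eq_or_ne p P with rfl | hne
      · exfalso
        simp only [symbolicPower, Ideal.mem_iInf] at ht
        have := ht ⟨p, hpp⟩ hp
        rw [Ideal.mem_comap,
          IsLocalization.algebraMap_mem_map_algebraMap_iff (M := p.primeCompl)] at this
        obtain ⟨s, hs, hst⟩ := this
        exact hs (hTP (Submodule.mem_colon_singleton.2 hst))
      · have hdim : ringKrullDim (R ⧸ p) ≤ 1 := by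
          refine (ringKrullDim_quotient_le_card hpp.ne_top (S := {x}) (by simpa using hx)
            (hrad.trans (Ideal.radical_mono ?_))).trans (by simp)
          rw [Finset.coe_singleton]
          exact sup_le_sup_right hp.1.2 _
        have hdim' : Ring.KrullDimLE 1 (R ⧸ p) := Ring.krullDimLE_iff.2 (by exact_mod_cast hdim)
        have hcomap : (P.map (Ideal.Quotient.mk p)).comap (Ideal.Quotient.mk p) = P := by
          rw [Ideal.comap_map_of_surjective _ Ideal.Quotient.mk_surjective, ← RingHom.ker,
            Ideal.mk_ker, sup_eq_left.2 hpP]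
        have hprime : (P.map (Ideal.Quotient.mk p)).IsPrime :=
          Ideal.map_isPrime_of_surjective Ideal.Quotient.mk_surjective (by rwa [Ideal.mk_ker])
        have hbot : P.map (Ideal.Quotient.mk p) ≠ ⊥ := fun h => hne <| le_antisymm hpP <| by
          rwa [Ideal.map_eq_bot_iff_le_ker, Ideal.mk_ker] at h
        have hmax := Ring.krullDimLE_one_iff_of_noZeroDivisors.1 hdim' _ hbot hprime
        have := Ideal.comap_isMaximal_of_surjective (Ideal.Quotient.mk p)
          Ideal.Quotient.mk_surjective (K := P.map (Ideal.Quotient.mk p))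
        rw [hcomap] at this
        exact eq_maximalIdeal this ▸ hx
    obtain ⟨k, hk⟩ := hmem
    exact hJ.pow k t (hle (Submodule.mem_colon_singleton.1 hk))
  · simp only [symbolicPower, Ideal.mem_iInf]
    intro p hp
    obtain ⟨k, hk⟩ := htor t ht
    rw [Ideal.mem_comap,
      IsLocalization.algebraMap_mem_map_algebraMap_iff (M := p.asIdeal.primeCompl)]
    exact ⟨x ^ k, fun h => hxp _ hp (p.2.mem_of_pow_mem _ h), hk⟩

theorem moduleDepth_quotient_pos {R : Type*} [CommRing R] [IsLocalRing R] [IsNoetherianRing R]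
    {J : Ideal R} (hJ : J ≠ ⊤) {x : R} (hx : x ∈ maximalIdeal R) (h : IsRegularMod J x) :
    0 < moduleDepth R (R ⧸ J) := by
  have : Nontrivial (R ⧸ J) := Ideal.Quotient.nontrivial_iff.2 hJ
  have hmem : ∀ r ∈ [x], r ∈ maximalIdeal R := by simpa using hx
  have hreg : RingTheory.Sequence.IsRegular (R ⧸ J) [x] :=
    .of_isWeaklyRegular_of_mem_maximalIdeal _ hmem <|
      (RingTheory.Sequence.isWeaklyRegular_singleton_iff _ x).2 (isRegularMod_iff_isSMulRegular.1 h)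
  exact lt_of_lt_of_le zero_lt_one
    (le_iSup₂_of_le (f := fun (rs : List R) (_ : (∀ r ∈ rs, r ∈ maximalIdeal R) ∧
      RingTheory.Sequence.IsRegular (R ⧸ J) rs) => (rs.length : ℕ∞)) [x] ⟨hmem, hreg⟩ (by simp))

/-! ### The colon ideal, the symbolic cube and the length for the matrix. -/

namespace CyclicMatrix

variable {R : Type*} [CommRing R] (D : CyclicMatrix R)

/-- A cubic monomial in a, b, c is either abc or divisible by a square. -/
theorem span_cube_le_conductor : Ideal.span {D.a, D.b, D.c} ^ 3 ≤ D.conductor := by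
  rw [pow_succ, pow_two, Ideal.span_mul_span', Ideal.span_mul_span', Ideal.span_le]
  have key : ∀ k ∈ D.conductor, ∀ s t, t = s * k → t ∈ D.conductor := fun k hk s t ht =>
    ht ▸ Ideal.mul_mem_left _ _ hk
  have ha := key (D.a ^ 2) (Ideal.subset_span (by simp))
  have hb := key (D.b ^ 2) (Ideal.subset_span (by simp))
  have hc := key (D.c ^ 2) (Ideal.subset_span (by simp))
  have habc := key (D.a * D.b * D.c) (Ideal.subset_span (by simp)) 1
  rintro _ ⟨_, ⟨p, hp, q, hq, rfl⟩, r, hr, rfl⟩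
  simp only [Set.mem_insert_iff, Set.mem_singleton_iff] at hp hq hr
  rw [SetLike.mem_coe]
  rcases hp with rfl | rfl | rfl <;> rcases hq with rfl | rfl | rfl <;>
    rcases hr with rfl | rfl | rfl <;>
  first
  | exact ha D.a _ (by ring1)
  | exact ha D.b _ (by ring1)
  | exact ha D.c _ (by ring1)
  | exact hb D.a _ (by ring1)
  | exact hb D.b _ (by ring1)
  | exact hb D.c _ (by ring1)
  | exact hc D.a _ (by ring1)
  | exact hc D.b _ (by ring1)
  | exact hc D.c _ (by ring1)
  | exact habc _ (by ring1)

theorem a_sq_mem_conductor : D.a ^ 2 ∈ D.conductor := Ideal.subset_span (by simp)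

variable [CharP R 2]

theorem conductor_eq_colon : (D.ideal ^ 3).colon {D.d} = D.conductor := by
  ext t
  rw [Submodule.mem_colon_singleton, smul_eq_mul, D.mul_d_mem_cube_iff]

theorem mul_mem_cube {s t : R} (hs : s ∈ D.conductor) (ht : t ∈ D.thirdSymbolic) :
    s * t ∈ D.ideal ^ 3 := by
  obtain ⟨w, hw⟩ := mem_sup_span_singleton'.1 ht
  have := add_mem (Ideal.mul_mem_left _ s hw) (Ideal.mul_mem_left _ w (D.conductor_mul_d_mem hs))
  convert! this using 1
  ring

/-- For the inclusion in `thirdSymbolic`, the single element a³ of the cube suffices, a being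
regular there. -/
theorem colon_span_cube : (D.ideal ^ 3).colon
    ((Ideal.span {D.a, D.b, D.c} ^ 3 : Ideal R) : Set R) = D.thirdSymbolic := by
  refine le_antisymm (fun t ht => ?_) fun t ht => ?_
  · have := Submodule.mem_colon.1 ht (D.a ^ 3)
      (Ideal.pow_mem_pow (Ideal.subset_span (by simp)) 3)
    rw [smul_eq_mul, mul_comm] at this
    exact D.isRegularMod_thirdSymbolic.pow 3 t (Ideal.mem_sup_left this)
  · refine Submodule.mem_colon.2 fun s hs => ?_
    rw [smul_eq_mul, mul_comm]
    exact D.mul_mem_cube (D.span_cube_le_conductor hs) ht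

/-- Otherwise a² ∈ I³ ⊆ I, and regularity of a modulo I puts 1 in I. -/
theorem thirdSymbolic_ne_top (h : D.ideal ≠ ⊤) : D.thirdSymbolic ≠ ⊤ := by
  intro htop
  have h1 := D.mul_mem_cube D.a_sq_mem_conductor (htop ▸ Submodule.mem_top : (1 : R) ∈ _)
  exact h ((Ideal.eq_top_iff_one _).2 (D.isRegularMod_ideal.pow 2 1
    (Ideal.pow_le_self three_ne_zero h1)))

theorem quotientLength_thirdSymbolic :
    quotientLength D.thirdSymbolic (D.ideal ^ 3) = Module.length R (R ⧸ D.conductor) := by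
  rw [thirdSymbolic, quotientLength_sup_span, conductor_eq_colon]

theorem symbolicPower_eq [IsLocalRing R] [IsNoetherianRing R] (ha : D.a ∈ maximalIdeal R)
    (hrad : maximalIdeal R ≤ (D.ideal ⊔ Ideal.span {D.a}).radical) :
    symbolicPower D.ideal 3 = D.thirdSymbolic :=
  symbolicPower_eq_of_isRegularMod ha D.isRegularMod_ideal hrad le_sup_left
    D.isRegularMod_thirdSymbolic fun _ ht => ⟨2, D.mul_mem_cube D.a_sq_mem_conductor ht⟩

end CyclicMatrix

/-! ### Specialization to a system of parameters. -/

theorem maximalMinorsIdeal_two_three {R : Type*} [CommRing R] (A : Matrix (Fin 2) (Fin 3) R) :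
    maximalMinorsIdeal A = Ideal.span {A 0 1 * A 1 2 - A 0 2 * A 1 1,
      A 0 0 * A 1 2 - A 0 2 * A 1 0, A 0 0 * A 1 1 - A 0 1 * A 1 0} := by
  have hdet : ∀ e : Fin 2 ↪o Fin 3, (A.submatrix id e).det =
      A 0 (e 0) * A 1 (e 1) - A 0 (e 1) * A 1 (e 0) := fun e => by
    rw [Matrix.det_fin_two]; rfl
  refine le_antisymm (Ideal.span_le.2 ?_) (Ideal.span_le.2 ?_)
  · rintro _ ⟨e, rfl⟩
    refine Ideal.subset_span ?_
    have hlt : e 0 < e 1 := e.strictMono (by decide)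
    simp only [hdet]
    generalize e 0 = i at *
    generalize e 1 = j at *
    fin_cases i <;> fin_cases j <;> simp at hlt ⊢
  · rintro _ (rfl | rfl | rfl)
    · exact Ideal.subset_span
        ⟨OrderEmbedding.ofStrictMono ![1, 2] (by decide), (hdet _).trans (by simp)⟩
    · exact Ideal.subset_span
        ⟨OrderEmbedding.ofStrictMono ![0, 2] (by decide), (hdet _).trans (by simp)⟩
    · exact Ideal.subset_span
        ⟨OrderEmbedding.ofStrictMono ![0, 1] (by decide), (hdet _).trans (by simp)⟩

section SystemOfParameters

variable {R : Type*} [CommRing R] [IsLocalRing R] [IsNoetherianRing R] {x y z : R}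

theorem isPowerRegular_of_radical_span_eq (h : HasRegularSeqMod 3 (⊥ : Ideal R))
    (hx : x ∈ maximalIdeal R) (hy : y ∈ maximalIdeal R) (hz : z ∈ maximalIdeal R)
    (hm : maximalIdeal R ≤ (Ideal.span {x, y, z}).radical) : IsPowerRegular x y z := by
  have key : ∀ {x y z : R}, x ∈ maximalIdeal R → y ∈ maximalIdeal R → z ∈ maximalIdeal R →
      maximalIdeal R ≤ (Ideal.span {x, y, z}).radical → ∀ i j,
        IsRegularMod (Ideal.span {x ^ i, y ^ j}) z := fun {x y z} hx hy hz hm i j => by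
    obtain ⟨h1, h2, h3⟩ := isRegularMod_of_radical_span_eq h hx hy hz hm
    obtain ⟨h4, -, -⟩ := isRegularMod_of_radical_span_eq h hy hx hz (by rwa [Set.insert_comm])
    exact isRegularMod_span_pow_pow h1 h2 h3 h4 i j
  have e1 : ({y, z, x} : Set R) = {x, y, z} := by ext; simp; tauto
  exact ⟨key hy hz hx (by rwa [e1]), key hx hz hy (by rwa [Set.pair_comm z y]), key hx hy hz hm⟩

end SystemOfParameters

theorem theorem4p13 {R : Type*} [CommRing R] [IsCohenMacaulayLocalRing R] [CharP R 2]
    (hdim : ringKrullDim R = 3)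
    (x y z : R) (hxyz : IsSystemOfParameters ![x, y, z])
    (α β γ α' β' γ' : ℕ) (hβ : 0 < β) (hγ : 0 < γ)
    (hα : α = 1) (hα' : α' = 2) (hββ' : 2 * β ≤ β') (hγγ' : 2 * γ ≤ γ')
    (I Q : Ideal R)
    (hI : I = maximalMinorsIdeal !![x ^ α, y ^ β, z ^ γ; y ^ β', z ^ γ', x ^ α'])
    (hQ : Q = Ideal.span {x ^ min α α', y ^ min β β', z ^ min γ γ'}) :
    0 < moduleDepth R (R ⧸ (I ^ 3).colon ((Q ^ 3 : Ideal R) : Set R)) ∧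
    symbolicPower I 3 = (I ^ 3).colon ((Q ^ 3 : Ideal R) : Set R) ∧
    quotientLength (symbolicPower I 3) (I ^ 3) = 7 * Module.length R (R ⧸ Q) ∧
    7 * Module.length R (R ⧸ Q) =
      7 * (β : ℕ∞) * (γ : ℕ∞) * Module.length R (R ⧸ Ideal.span {x, y, z}) := by
  subst hα hα'
  have hseq : HasRegularSeqMod 3 (⊥ : Ideal R) := by
    refine hasRegularSeqMod_of_le_moduleDepth ?_
    have := (IsCohenMacaulayLocalRing.depth_eq_dim (R := R)).trans hdim
    exact WithBot.coe_le_coe.1 this.ge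
  have hrad : (Ideal.span {x, y, z}).radical = maximalIdeal R := by
    rw [← hxyz.2]
    congr 2
    ext t
    simp [eq_comm]
    tauto
  have hmem : ∀ t ∈ ({x, y, z} : Set R), t ∈ maximalIdeal R := fun t ht =>
    hrad ▸ Ideal.le_radical (Ideal.subset_span ht)
  have hx : x ∈ maximalIdeal R := hmem x (by simp)
  have hy : y ∈ maximalIdeal R := hmem y (by simp)
  have hz : z ∈ maximalIdeal R := hmem z (by simp)
  obtain ⟨h1, h2, h3⟩ := isRegularMod_of_radical_span_eq hseq hx hy hz hrad.ge
  have hpow := isPowerRegular_of_radical_span_eq hseq hx hy hz hrad.ge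
  let D : CyclicMatrix R :=
    { a := x
      b := y ^ β
      c := z ^ γ
      u := y ^ (β' - 2 * β)
      v := z ^ (γ' - 2 * γ)
      Y := Submonoid.powers y
      Z := Submonoid.powers z
      b_mem := ⟨_, rfl⟩
      u_mem := ⟨_, rfl⟩
      c_mem := ⟨_, rfl⟩
      v_mem := ⟨_, rfl⟩
      regular_a := h1
      regular_Y := by
        rintro _ ⟨n, rfl⟩
        exact h2.pow n
      regular_Z := by
        rintro _ ⟨j, rfl⟩ _ ⟨k, rfl⟩
        rw [Ideal.span_insert] at h3
        exact (h2.of_pow h3 j).pow k }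
  have hyβ : y ^ β' = y ^ (β' - 2 * β) * (y ^ β) ^ 2 := by
    rw [← pow_mul, ← pow_add]; congr 1; omega
  have hzγ : z ^ γ' = z ^ (γ' - 2 * γ) * (z ^ γ) ^ 2 := by
    rw [← pow_mul, ← pow_add]; congr 1; omega
  have hID : I = D.ideal := by
    have hf : y ^ β * x ^ 2 - z ^ γ * z ^ γ' = D.f := by
      rw [CharTwo.sub_eq_add, hzγ]; simp only [CyclicMatrix.f, D]; ring
    have hg : x * x ^ 2 - z ^ γ * y ^ β' = D.g := by
      rw [CharTwo.sub_eq_add, hyβ]; simp only [CyclicMatrix.g, D]; ring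
    have hh : x * z ^ γ' - y ^ β * y ^ β' = D.h := by
      rw [CharTwo.sub_eq_add, hyβ, hzγ]; simp only [CyclicMatrix.h, D]; ring
    rw [hI, maximalMinorsIdeal_two_three, CyclicMatrix.ideal, ← hf, ← hg, ← hh]
    simp
  have hQD : Q = Ideal.span {D.a, D.b, D.c} := by
    rw [hQ, min_eq_left (by omega : 1 ≤ 2), min_eq_left (by omega : β ≤ β'),
      min_eq_left (by omega : γ ≤ γ'), pow_one]
  have hQlen : Module.length R (R ⧸ Q) =
      β * γ * Module.length R (R ⧸ Ideal.span {x, y, z}) := by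
    have := hpow.length_quotient_span_pow 1 β γ
    rw [pow_one] at this
    rw [hQD, this, Nat.cast_one, one_mul]
  have hDm : D.ideal ≤ maximalIdeal R := by
    have hb := Ideal.pow_mem_of_mem _ hy β hβ
    have hc := Ideal.pow_mem_of_mem _ hz γ hγ
    refine Ideal.span_le.2 ?_
    rintro _ (rfl | rfl | rfl)
    · exact add_mem (Ideal.mul_mem_left _ _ hb)
        (Ideal.mul_mem_left _ _ (Ideal.pow_mem_of_mem _ hc 3 three_pos))
    · exact add_mem (Ideal.pow_mem_of_mem _ hx 3 three_pos) (Ideal.mul_mem_left _ _ hc)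
    · exact add_mem (Ideal.mul_mem_left _ _ (Ideal.pow_mem_of_mem _ hb 3 three_pos))
        (Ideal.mul_mem_left _ _ (Ideal.pow_mem_of_mem _ hc 2 two_pos))
  have hDrad : maximalIdeal R ≤ (D.ideal ⊔ Ideal.span {D.a}).radical := by
    rw [← hrad, Ideal.radical_le_radical_iff, Ideal.span_le]
    rintro _ (rfl | rfl | rfl)
    · exact Ideal.le_radical (Ideal.mem_sup_right (Ideal.mem_span_singleton_self _))
    -- Modulo a, h and f reduce to u b³ and v c³, pure powers of y and z; the exponents and
    -- witnesses here and in the next case come from this.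
    · refine ⟨β' - 2 * β + β * 3, mem_sup_span_singleton'.2 ⟨- (D.v * D.c ^ 2), ?_⟩⟩
      convert! D.h_mem using 1
      simp only [CyclicMatrix.h, D]
      ring
    · refine ⟨γ' - 2 * γ + γ * 3, mem_sup_span_singleton'.2 ⟨- (D.a * D.b), ?_⟩⟩
      convert! D.f_mem using 1
      simp only [CyclicMatrix.f, D]
      ring
  have hcolon : (I ^ 3).colon ((Q ^ 3 : Ideal R) : Set R) = D.thirdSymbolic := by
    rw [hID, hQD, D.colon_span_cube]
  have hsymb : symbolicPower I 3 = D.thirdSymbolic := by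
    rw [hID, D.symbolicPower_eq hx hDrad]
  refine ⟨?_, hsymb.trans hcolon.symm, ?_, ?_⟩
  · rw [hcolon]
    exact moduleDepth_quotient_pos
      (D.thirdSymbolic_ne_top fun h => (maximalIdeal.isMaximal R).ne_top (top_le_iff.1 (h ▸ hDm)))
      hx D.isRegularMod_thirdSymbolic
  · have := hpow.length_quotient_conductor 1 β γ
    rw [pow_one] at this
    rw [hsymb, hID, D.quotientLength_thirdSymbolic, hQD]
    exact this
  · rw [hQlen]
    ring
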